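/- A *ribbon graph* with $e\ge 1$ edges is a triple $\Gamma=(H,\alpha,\sigma)$, where $H=\{1,\dots,2e\}$ is the set of half-edges, $\alpha\in S_{2e}$ is a fixed-point-free involution, $\sigma\in S_{2e}$, and $\langle\alpha,\sigma\rangle$ acts transitively on $H$. Its vertices are the cycles of $\sigma$ and its faces are the cycles of $\sigma^{-1}\circ\alpha$ (fixed points count as cycles); with $n$ vertices and $f$ faces, its genus $g$ is defined by $n-e+f=2-2g$. A *marked graph* $\Gamma_v$ is a ribbon graph whose vertices are labelled $1,\dots,n$; a *marked isomorphism* is a bijection of the half-edges that intertwines the permutations $\alpha$ and the permutations $\sigma$ and preserves the labels of the vertices, and $\mathrm{Aut}_v(\Gamma_v)$ is the group of marked automorphisms. For positive integers $\mu_1,\dots,\mu_n$ let $G_{g,n}(\mu_1,\dots,\mu_n)$ be the set of marked-isomorphism classes of marked graphs of genus $g$ with $n$ vertices such that the vertex labelled $i$ is incident to exactly $\mu_i$ half-edges, and put $$C_{g,n}(\mu_1,\dots,\mu_n)=\mu_1\cdots\mu_n\sum_{\Gamma_v\in G_{g,n}(\mu_1,\dots,\mu_n)}\frac{1}{|\mathrm{Aut}_v(\Gamma_v)|}.$$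 Then for all integers $\mu_1,\mu_2\ge 1$ $$C_{0,2}(\mu_1,\mu_2)=\frac{1+(-1)^{\mu_1+\mu_2}}{\mu_1+\mu_2}\;g(\mu_1)\,g(\mu_2),\qquad g(\mu)=2^{[\mu/2]}\,\frac{\bigl(2\bigl[\tfrac{\mu-1}{2}\bigr]+1\bigr)!!}{\bigl[\tfrac{\mu-1}{2}\bigr]!},$$ where $[x]$ denotes the integer part of $x$. -/

import Mathlib

namespace RibbonGraphs

/-- A (connected) ribbon graph with `e ≥ 1` edges, on the set of half-edges `Fin (2 * e)`:
`α` pairs the half-edges into edges, the cycles of `σ` (fixed points included) are the vertices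
with the cyclic order of their half-edges, and `α`, `σ` generate a transitive group. -/
structure RibbonGraph (e : ℕ) where
  e_pos : 0 < e
  α : Equiv.Perm (Fin (2 * e))
  σ : Equiv.Perm (Fin (2 * e))
  α_involutive : ∀ h, α (α h) = h
  α_fixedPointFree : ∀ h, α h ≠ h
  connected : ∀ h h' : Fin (2 * e), ∃ τ ∈ Subgroup.closure {α, σ}, τ h = h'

/-- The number of faces: the number of cycles (fixed points included) of `σ⁻¹ ∘ α`. -/
noncomputable def RibbonGraph.numFaces {e : ℕ} (Γ : RibbonGraph e) : ℕ :=
  Nat.card (Quotient (Equiv.Perm.SameCycle.setoid (Γ.σ⁻¹ * Γ.α)))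

/-- A marked graph: a ribbon graph with `n` vertices labelled by `Fin n`. The labelling is recorded
as the map sending a half-edge to the label of its vertex; its fibres are exactly the
cycles of `σ`, so it is the same as a bijection from the set of cycles of `σ` onto `Fin n`. -/
structure MarkedGraph (e n : ℕ) extends RibbonGraph e where
  vert : Fin (2 * e) → Fin n
  vert_surjective : Function.Surjective vert
  vert_eq_iff : ∀ h h', vert h = vert h' ↔ σ.SameCycle h h'

namespace MarkedGraph

variable {e n : ℕ}

/-- The degree of the vertex with label `i`: the number of half-edges incident to it. -/
def degree (Γ : MarkedGraph e n) (i : Fin n) : ℕ :=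
  (Finset.univ.filter (fun h => Γ.vert h = i)).card

/-- The graph has genus `g`, by Euler's relation `n - e + f = 2 - 2 g`. -/
def HasGenus (Γ : MarkedGraph e n) (g : ℕ) : Prop :=
  (n : ℤ) - (e : ℤ) + (Γ.numFaces : ℤ) = 2 - 2 * (g : ℤ)

/-- `ψ` is a marked isomorphism: a relabelling of the half-edges that intertwines
`α` with `α'` and `σ` with `σ'` and preserves the labels of the vertices. -/
def IsMarkedIso (Γ Γ' : MarkedGraph e n) (ψ : Equiv.Perm (Fin (2 * e))) : Prop :=
  Γ'.α * ψ = ψ * Γ.α ∧ Γ'.σ * ψ = ψ * Γ.σ ∧ ∀ h, Γ'.vert (ψ h) = Γ.vert h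

theorem IsMarkedIso.one (Γ : MarkedGraph e n) : IsMarkedIso Γ Γ 1 :=
  ⟨by simp, by simp, fun _ => rfl⟩

theorem IsMarkedIso.mul {Γ₁ Γ₂ Γ₃ : MarkedGraph e n} {ψ φ : Equiv.Perm (Fin (2 * e))}
    (hφ : IsMarkedIso Γ₂ Γ₃ φ) (hψ : IsMarkedIso Γ₁ Γ₂ ψ) : IsMarkedIso Γ₁ Γ₃ (φ * ψ) := by
  refine ⟨?_, ?_, fun h => ?_⟩
  · rw [← mul_assoc, hφ.1, mul_assoc, hψ.1, mul_assoc]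
  · rw [← mul_assoc, hφ.2.1, mul_assoc, hψ.2.1, mul_assoc]
  · rw [Equiv.Perm.mul_apply, hφ.2.2, hψ.2.2]

theorem IsMarkedIso.inv {Γ₁ Γ₂ : MarkedGraph e n} {ψ : Equiv.Perm (Fin (2 * e))}
    (hψ : IsMarkedIso Γ₁ Γ₂ ψ) : IsMarkedIso Γ₂ Γ₁ ψ⁻¹ := by
  refine ⟨?_, ?_, fun h => ?_⟩
  · rw [eq_inv_mul_iff_mul_eq, ← mul_assoc, ← hψ.1, mul_inv_cancel_right]
  · rw [eq_inv_mul_iff_mul_eq, ← mul_assoc, ← hψ.2.1, mul_inv_cancel_right]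
  · rw [← hψ.2.2]; simp

/-- `|Aut_v(Γ)|`, the number of automorphisms fixing every vertex. -/
noncomputable def autCard (Γ : MarkedGraph e n) : ℕ :=
  Nat.card {ψ : Equiv.Perm (Fin (2 * e)) // IsMarkedIso Γ Γ ψ}

theorem IsMarkedIso.autCard_eq {Γ₁ Γ₂ : MarkedGraph e n} {ψ : Equiv.Perm (Fin (2 * e))}
    (hψ : IsMarkedIso Γ₁ Γ₂ ψ) : Γ₁.autCard = Γ₂.autCard :=
  Nat.card_congr
    { toFun := fun a => ⟨ψ * a.1 * ψ⁻¹, (hψ.mul a.2).mul hψ.inv⟩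
      invFun := fun b => ⟨ψ⁻¹ * b.1 * ψ, (hψ.inv.mul b.2).mul hψ⟩
      left_inv := fun a => Subtype.ext (by simp [mul_assoc])
      right_inv := fun b => Subtype.ext (by simp [mul_assoc]) }

theorem sum_degree (Γ : MarkedGraph e n) : ∑ i, Γ.degree i = 2 * e := by
  have h := Finset.card_eq_sum_card_fiberwise (f := Γ.vert) (s := Finset.univ)
    (t := Finset.univ) (fun _ _ => Finset.mem_coe.2 (Finset.mem_univ _))
  rw [Finset.card_univ, Fintype.card_fin] at h
  exact h.symm

instance : Finite (MarkedGraph e n) := by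
  refine Finite.of_injective
    (fun Γ : MarkedGraph e n => (Γ.α, Γ.σ, Γ.vert)) ?_
  rintro ⟨⟨_, _, _, _, _, _⟩, _, _, _⟩ ⟨⟨_, _, _, _, _, _⟩, _, _, _⟩ h
  simp only [Prod.mk.injEq] at h
  obtain ⟨rfl, rfl, rfl⟩ := h
  rfl

end MarkedGraph

/-- Marked graphs with `e` edges and `n` vertices, of genus `g`, whose vertex `i` has
degree `μ i`. -/
def GraphData (g n : ℕ) (μ : Fin n → ℕ) (e : ℕ) : Type :=
  {Γ : MarkedGraph e n // Γ.HasGenus g ∧ ∀ i, Γ.degree i = μ i}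

/-- Two marked graphs are identified if there is a marked isomorphism between them. -/
instance graphSetoid (g n : ℕ) (μ : Fin n → ℕ) (e : ℕ) : Setoid (GraphData g n μ e) where
  r Γ Γ' := ∃ ψ, MarkedGraph.IsMarkedIso Γ.1 Γ'.1 ψ
  iseqv :=
    { refl := fun Γ => ⟨1, MarkedGraph.IsMarkedIso.one Γ.1⟩
      symm := fun ⟨ψ, h⟩ => ⟨ψ⁻¹, h.inv⟩
      trans := fun ⟨ψ, h⟩ ⟨φ, h'⟩ => ⟨φ * ψ, h'.mul h⟩ }

/-- The set `G_{g,n}(μ)` of distinct marked graphs of genus `g` with `n` vertices of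
degrees `μ 0, …, μ (n - 1)` (with any number `e ≥ 1` of edges). -/
def MarkedGraphs (g n : ℕ) (μ : Fin n → ℕ) : Type :=
  Σ e : ℕ, Quotient (graphSetoid g n μ e)

instance (g n : ℕ) (μ : Fin n → ℕ) : Finite (MarkedGraphs g n μ) := by
  have hfin : ∀ e, Finite (Quotient (graphSetoid g n μ e)) := fun e => by
    have : Finite (GraphData g n μ e) := Subtype.finite
    infer_instance
  have hle : ∀ Γ : MarkedGraphs g n μ, Γ.1 < (∑ i, μ i) + 1 := by
    rintro ⟨e, q⟩
    induction q using Quotient.inductionOn with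
    | h Γ =>
      have h : ∑ i, μ i = 2 * e :=
        (Finset.sum_congr rfl (fun i _ => (Γ.2.2 i).symm)).trans Γ.1.sum_degree
      change e < (∑ i, μ i) + 1
      omega
  refine Finite.of_injective (β := Σ e : Fin ((∑ i, μ i) + 1), Quotient (graphSetoid g n μ e))
    (fun Γ => ⟨⟨Γ.1, hle Γ⟩, Γ.2⟩) ?_
  rintro ⟨e, q⟩ ⟨e', q'⟩ h
  simp only [Sigma.mk.injEq, Fin.mk.injEq] at h
  obtain ⟨rfl, h⟩ := h
  rw [eq_of_heq h]

/-- `|Aut_v(Γ)|` for an element of `G_{g,n}(μ)`. -/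
noncomputable def MarkedGraphs.autCard {g n : ℕ} {μ : Fin n → ℕ} (Γ : MarkedGraphs g n μ) : ℕ :=
  Quotient.lift (fun Γ' : GraphData g n μ Γ.1 => Γ'.1.autCard)
    (fun _ _ h => Exists.elim h fun _ hψ => hψ.autCard_eq) Γ.2

/-- `D_{g,n}(μ)`: the graphs of the (finite) set `G_{g,n}(μ)`, each counted with
weight `1 / |Aut_v(Γ)|`. -/
noncomputable def D (g n : ℕ) (μ : Fin n → ℕ) : ℚ :=
  ∑ᶠ Γ : MarkedGraphs g n μ, (1 : ℚ) / (Γ.autCard : ℚ)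

/-- `C_{g,n}(μ) = μ_1 ⋯ μ_n D_{g,n}(μ)`, with the convention `C_{0,1}(0) = 1` for the graph
consisting of a single point. -/
noncomputable def C (g n : ℕ) (μ : Fin n → ℕ) : ℚ :=
  if g = 0 ∧ n = 1 ∧ (∀ i, μ i = 0) then 1 else (∏ i, (μ i : ℚ)) * D g n μ

/-- `g(μ) = 2^[μ/2] (2 [(μ-1)/2] + 1)!! / [(μ-1)/2]!`, for `μ ≥ 1`. -/
def gFun (μ : ℕ) : ℚ :=
  2 ^ (μ / 2) * (Nat.doubleFactorial (2 * ((μ - 1) / 2) + 1) : ℚ) /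
    (Nat.factorial ((μ - 1) / 2) : ℚ)

end RibbonGraphs

/-! The weighted sum over graphs is an honest count. Choosing a first half-edge at each vertex
identifies the half-edges with the points of two circles. There are `μ₁ μ₂` such rootings, and those
of a given graph inducing the same pairing differ by its automorphisms. Hence `C_{0,2}(μ₁, μ₂)` is
the number of planar pairings of the points of two circles that link the circles (`C_eq_count`, from
`card_isRooting` and `card_fiber_mul_autCard`); if `μ₁ + μ₂` is odd there is no graph at all.

The pairings are counted by deleting pairs of neighbours. Inserting or deleting such a pair changes
the number of faces by one and so preserves planarity (`numCycles_addPair`). Forbidding neighbouring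
pairs one position at a time gives the recurrences `reducedCount_succ` and `reducedCount_self`.
Their solution (`reduced_eq_sum_cyclic`) says that a pairing with `n` points on the first circle
contributes through a core with `n - 2m` points there and no neighbours paired, with multiplicity
`binom n m`. Exchanging the circles and repeating the argument reduces the count to pairings without
neighbouring pairs on either circle. Planarity then makes every face a 2-cycle, so the pairing
reverses the rotation: both circles have the same length `k`, and exactly `k` reflections remain
(`cyclicCount_true`).

What is left is a sum of products of two binomial coefficients with weight `k`, which telescopes
(`sum_offsetChoose`), and the identity `g(2a + r) = (a + r) binom (2a + r) a` for `r ≤ 1`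
(`gFun_eq_choose`). -/

namespace RibbonGraphs

open Equiv

/-! ### Cycles of a permutation and functions constant on them. -/

/-- The number of cycles of a permutation, fixed points included. -/
noncomputable def numCycles {H : Type*} (φ : Perm H) : ℕ :=
  Nat.card (Quotient (Perm.SameCycle.setoid φ))

theorem eq_of_sameCycle {H X : Type*} {φ : Perm H} {r : H → X} (hr : ∀ x, r (φ x) = r x)
    {x y : H} (h : φ.SameCycle x y) : r x = r y := by
  obtain ⟨i, rfl⟩ := h
  induction i with
  | zero => simp
  | succ n ih => rw [add_comm, zpow_add, Perm.mul_apply, zpow_one, hr]; exact ih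
  | pred n ih =>
    rw [ih]
    conv_lhs => rw [show (-(n : ℤ)) = 1 + (-(n : ℤ) - 1) by ring, zpow_add, Perm.mul_apply,
      zpow_one, hr]

theorem sameCycle_apply_iff {H K : Type*} {φ : Perm H} {ψ : Perm K} (e : H ≃ K)
    (he : ∀ x, e (φ x) = ψ (e x)) {x y : H} : ψ.SameCycle (e x) (e y) ↔ φ.SameCycle x y := by
  have he' : ∀ y, e.symm (ψ y) = φ (e.symm y) := fun y => by
    rw [Equiv.symm_apply_eq, he, Equiv.apply_symm_apply]
  refine ⟨fun h => ?_, fun h => ?_⟩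
  · have := eq_of_sameCycle
      (r := fun x => Quotient.mk (Perm.SameCycle.setoid φ) (e.symm x)) (fun z => ?_) h
    · simp only [Equiv.symm_apply_apply] at this
      exact Quotient.exact this
    · refine Quotient.sound ?_
      rw [he']
      exact Perm.sameCycle_apply_left.2 (Perm.SameCycle.refl _ _)
  · refine Quotient.exact (s := Perm.SameCycle.setoid ψ) (eq_of_sameCycle
      (r := fun x => Quotient.mk (Perm.SameCycle.setoid ψ) (e x)) (fun z => ?_) h)
    refine Quotient.sound ?_
    rw [he]
    exact Perm.sameCycle_apply_left.2 (Perm.SameCycle.refl _ _)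

theorem numCycles_conj {H K : Type*} {φ : Perm H} {ψ : Perm K} (e : H ≃ K)
    (he : ∀ x, e (φ x) = ψ (e x)) : numCycles φ = numCycles ψ :=
  Nat.card_congr (Quotient.congr e fun _ _ => (sameCycle_apply_iff e he).symm)

/-! ### Faces after the insertion of a pair of neighbours. -/

section AddPair

variable {H H' : Type*} (E : H' ⊕ Bool ≃ H)

/-- Extend a permutation by exchanging the two new points. -/
def addPair (α : Perm H') : Perm H := E.permCongr (Equiv.sumCongr α Equiv.boolNot)

@[simp] theorem addPair_inl (α : Perm H') (x : H') :
    addPair E α (E (Sum.inl x)) = E (Sum.inl (α x)) := by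
  simp [addPair, Equiv.permCongr_apply]

@[simp] theorem addPair_inr (α : Perm H') (b : Bool) :
    addPair E α (E (Sum.inr b)) = E (Sum.inr (!b)) := by
  simp [addPair, Equiv.permCongr_apply]

theorem forall_addPair {P : H → Prop} :
    (∀ x, P x) ↔ (∀ x, P (E (Sum.inl x))) ∧ ∀ b, P (E (Sum.inr b)) := by
  rw [← E.forall_congr_right, Sum.forall]

theorem addPair_injective : Function.Injective (addPair E) := by
  intro α β h
  ext x
  have := congrArg (fun f => f (E (Sum.inl x))) h
  simpa using this

/-- An involution that exchanges two points preserves their complement, so it restricts there. -/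
theorem exists_addPair {α : Perm H} (hα : ∀ x, α (α x) = x)
    (h : α (E (Sum.inr false)) = E (Sum.inr true)) : ∃ α' : Perm H', addPair E α' = α := by
  have h' : α (E (Sum.inr true)) = E (Sum.inr false) := by rw [← h, hα]
  have key : ∀ x : H', ∃ y : H', α (E (Sum.inl x)) = E (Sum.inl y) := by
    intro x
    obtain ⟨z, hz⟩ := E.surjective (α (E (Sum.inl x)))
    rcases z with y | b
    · exact ⟨y, hz.symm⟩
    · exfalso
      have := congrArg α hz
      rw [hα] at this
      cases b
      · rw [h] at this; simpa using E.injective this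
      · rw [h'] at this; simpa using E.injective this
  choose f hf using key
  have hff : Function.Involutive f := fun x => by
    have := hα (E (Sum.inl x))
    rw [hf, hf] at this
    simpa using this
  refine ⟨hff.toPerm, ?_⟩
  ext x
  revert x
  rw [forall_addPair E]
  refine ⟨fun x => ?_, fun b => ?_⟩
  · simp [hf]
  · cases b <;> simp [h, h']

theorem addPair_involutive {α : Perm H'} :
    (∀ x, addPair E α (addPair E α x) = x) ↔ ∀ x, α (α x) = x := by
  rw [forall_addPair E]; simp

theorem addPair_fixedPointFree {α : Perm H'} :
    (∀ x, addPair E α x ≠ x) ↔ ∀ x, α x ≠ x := by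
  rw [forall_addPair E]; simp

/-- The new points are consecutive for `σ`, just before `z`, and paired with each other. The first
becomes a fixed point of `σ⁻¹ α`, a new face; the second is spliced into the old face through `σ'⁻¹
z`. -/
theorem numCycles_addPair [Finite H'] [DecidableEq H'] {σ : Perm H} {σ' : Perm H'} {z : H'}
    (h₁ : σ (E (Sum.inr false)) = E (Sum.inr true)) (h₂ : σ (E (Sum.inr true)) = E (Sum.inl z))
    (h₃ : ∀ x, σ (E (Sum.inl x)) = if σ' x = z then E (Sum.inr false) else E (Sum.inl (σ' x)))
    (α : Perm H') : numCycles (σ⁻¹ * addPair E α) = numCycles (σ'⁻¹ * α) + 1 := by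
  set φ := σ⁻¹ * addPair E α with hφ
  set φ' := σ'⁻¹ * α with hφ'
  have i₁ : φ (E (Sum.inr false)) = E (Sum.inr false) := by
    simp [hφ, Equiv.symm_apply_eq, h₁]
  have i₂ : φ (E (Sum.inr true)) = E (Sum.inl (σ'⁻¹ z)) := by
    simp [hφ, Equiv.symm_apply_eq, h₃]
  have i₃ : ∀ x, φ (E (Sum.inl x)) =
      if α x = z then E (Sum.inr true) else E (Sum.inl (φ' x)) := fun x => by
    by_cases hx : α x = z <;> simp [hφ, hφ', Equiv.symm_apply_eq, h₂, h₃, hx]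
  let s := Perm.SameCycle.setoid φ
  let s' := Perm.SameCycle.setoid φ'
  -- `none` stands for the face consisting of the first new point alone.
  let r₀ : H' ⊕ Bool → Option (Quotient s') := Sum.elim (fun x => some (Quotient.mk s' x))
    (fun b => if b then some (Quotient.mk s' (σ'⁻¹ z)) else none)
  let r : H → Option (Quotient s') := fun x => r₀ (E.symm x)
  have hr' : ∀ x, Quotient.mk s' (φ' x) = Quotient.mk s' x := fun x =>
    Quotient.sound (Perm.sameCycle_apply_left.2 (Perm.SameCycle.refl _ _))
  have hs : ∀ x, Quotient.mk s (φ x) = Quotient.mk s x := fun x =>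
    Quotient.sound (Perm.sameCycle_apply_left.2 (Perm.SameCycle.refl _ _))
  have hr : ∀ x, r (φ x) = r x := by
    rw [forall_addPair E]
    refine ⟨fun x => ?_, fun b => ?_⟩
    · rw [i₃]
      split_ifs with hx
      · have := hr' x
        rw [hφ', Perm.mul_apply, hx] at this
        simpa [r, r₀] using this
      · simp [r, r₀, hr']
    · cases b
      · rw [i₁]
      · rw [i₂]; simp [r, r₀]
  let g : Quotient s' → Quotient s := Quotient.lift (fun x => Quotient.mk s (E (Sum.inl x)))
    fun x y h => eq_of_sameCycle (φ := φ')
      (r := fun x => Quotient.mk s (E (Sum.inl x))) (fun x => by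
        have := hs (E (Sum.inl x))
        rw [i₃] at this
        split_ifs at this with hx
        · have h2 := hs (E (Sum.inr true))
          rw [i₂, this] at h2
          rw [hφ', Perm.mul_apply, hx]
          exact h2
        · exact this) h
  have e : Quotient s ≃ Option (Quotient s') :=
    { toFun := Quotient.lift r fun x y h => eq_of_sameCycle hr h
      invFun := fun o => o.elim (Quotient.mk s (E (Sum.inr false))) g
      left_inv := by
        intro q
        induction q using Quotient.inductionOn with
        | h x =>
          revert x
          rw [forall_addPair E]
          refine ⟨fun x => ?_, fun b => ?_⟩
          · simp [r, r₀, g]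
          · cases b
            · simp [r, r₀]
            · have h2 := hs (E (Sum.inr true))
              rw [i₂] at h2
              simpa [r, r₀, g] using h2
      right_inv := by
        rintro (_ | q)
        · simp [r, r₀]
        · induction q using Quotient.inductionOn with
          | h x => simp [r, r₀, g] }
  unfold numCycles
  rw [Nat.card_congr e, Finite.card_option]

end AddPair

/-! ### Counting permutations by a property. -/

/-- The number of permutations with a given property. -/
noncomputable def count {H : Type*} (P : Perm H → Prop) : ℕ := Nat.card {α // P α}

theorem count_congr {H : Type*} {P Q : Perm H → Prop} (h : ∀ α, P α ↔ Q α) :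
    count P = count Q := by
  rw [funext fun α => propext (h α)]

theorem count_split {H : Type*} [Finite H] (P Q : Perm H → Prop) :
    count P = count (fun α => P α ∧ ¬ Q α) + count (fun α => P α ∧ Q α) := by
  classical
  unfold count
  rw [← Nat.card_sum]
  refine Nat.card_congr ((Equiv.sumCompl fun x : {α // P α} => ¬ Q x.1).symm.trans
    (Equiv.sumCongr (Equiv.subtypeSubtypeEquivSubtypeInter P fun α => ¬ Q α) ?_))
  refine (Equiv.subtypeSubtypeEquivSubtypeInter P fun α => ¬ ¬ Q α).trans
    (Equiv.subtypeEquivRight fun α => by simp)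

theorem count_eq_zero {H : Type*} {P : Perm H → Prop} (h : ∀ α, ¬ P α) : count P = 0 := by
  have : IsEmpty {α // P α} := ⟨fun α => h α.1 α.2⟩
  exact Nat.card_of_isEmpty

theorem count_eq_of_bijOn {H K : Type*} {P : Perm H → Prop} {Q : Perm K → Prop}
    (F : Perm H → Perm K) (hF : Function.Injective F) (h : ∀ α, Q (F α) ↔ P α)
    (hs : ∀ β, Q β → ∃ α, F α = β) : count P = count Q := by
  refine Nat.card_congr (Equiv.ofBijective (fun α => ⟨F α.1, (h _).2 α.2⟩) ⟨?_, ?_⟩)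
  · intro α β hαβ
    exact Subtype.ext (hF (congrArg Subtype.val hαβ))
  · rintro ⟨β, hβ⟩
    obtain ⟨α, rfl⟩ := hs β hβ
    exact ⟨⟨α, (h _).1 hβ⟩, rfl⟩

/-! ### Annular pairings and their reduced forms. -/

/-- The rotation of two disjoint circles with `μ` and `ν` points. -/
def circles (μ ν : ℕ) : Perm (Fin μ ⊕ Fin ν) := Equiv.sumCongr (finRotate μ) (finRotate ν)

@[simp] theorem circles_inl {μ ν : ℕ} (i : Fin μ) :
    circles μ ν (Sum.inl i) = Sum.inl (finRotate μ i) := rfl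

@[simp] theorem circles_inr {μ ν : ℕ} (j : Fin ν) :
    circles μ ν (Sum.inr j) = Sum.inr (finRotate ν j) := rfl

/-- A pairing of the points of two circles that is planar on the annulus and connects the
two circles. -/
structure IsAnnular {μ ν : ℕ} (α : Perm (Fin μ ⊕ Fin ν)) : Prop where
  involutive : ∀ x, α (α x) = x
  fixedPointFree : ∀ x, α x ≠ x
  link : ∃ i j, α (Sum.inl i) = Sum.inr j
  planar : 2 * numCycles ((circles μ ν)⁻¹ * α) = μ + ν

theorem finRotate_val {n : ℕ} (i : Fin n) :
    (finRotate n i : ℕ) = if (i : ℕ) + 1 = n then 0 else (i : ℕ) + 1 := by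
  cases n with
  | zero => exact i.elim0
  | succ n =>
    rw [coe_finRotate]
    have := i.2
    split_ifs with h₁ h₂ h₂
    · rfl
    · simp [h₁] at h₂
    · exact absurd (Fin.ext (by simp; omega)) h₁
    · rfl

/-- No two neighbours among the first `p` points of the first circle are paired; if `t` holds, no
two neighbours on the second circle are paired. -/
def Reduced (t : Prop) (p : ℕ) {μ ν : ℕ} (α : Perm (Fin μ ⊕ Fin ν)) : Prop :=
  (∀ i j : Fin μ, (i : ℕ) + 1 = j → (j : ℕ) < p → α (Sum.inl i) ≠ Sum.inl j) ∧
    (t → ∀ j, α (Sum.inr j) ≠ Sum.inr (finRotate ν j))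

/-- No two neighbours on the first circle are paired; if `t` holds, no
two neighbours on the second circle are paired. -/
def CyclicallyReduced (t : Prop) {μ ν : ℕ} (α : Perm (Fin μ ⊕ Fin ν)) : Prop :=
  (∀ i, α (Sum.inl i) ≠ Sum.inl (finRotate μ i)) ∧
    (t → ∀ j, α (Sum.inr j) ≠ Sum.inr (finRotate ν j))

/-! ### Inserting a pair of neighbours into the first circle. -/

section Insert

variable {μ ν : ℕ} {ι : Fin μ → Fin (μ + 2)} {a b : Fin (μ + 2)}

/-- Insert two points into the first circle. -/
noncomputable def insertEquiv (ν : ℕ) (hι : Function.Injective ι) (ha : ∀ i, ι i ≠ a)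
    (hb : ∀ i, ι i ≠ b) (hab : a ≠ b) : (Fin μ ⊕ Fin ν) ⊕ Bool ≃ Fin (μ + 2) ⊕ Fin ν :=
  Equiv.ofBijective
    (Sum.elim (Sum.map ι id) (fun c => Sum.inl (if c then b else a)))
    ((Fintype.bijective_iff_injective_and_card _).2 ⟨by
      rintro ((x | x) | (_ | _)) ((y | y) | (_ | _)) h <;>
        simp_all [hι.eq_iff, eq_comm], by simp; ring⟩)

variable (hι : Function.Injective ι) (ha : ∀ i, ι i ≠ a) (hb : ∀ i, ι i ≠ b) (hab : a ≠ b)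

theorem insertEquiv_inl (x : Fin μ ⊕ Fin ν) :
    insertEquiv ν hι ha hb hab (Sum.inl x) = Sum.map ι id x := rfl

theorem insertEquiv_false :
    insertEquiv ν hι ha hb hab (Sum.inr false) = Sum.inl a := rfl

theorem insertEquiv_true :
    insertEquiv ν hι ha hb hab (Sum.inr true) = Sum.inl b := rfl

theorem addPair_insertEquiv_inl (α : Perm (Fin μ ⊕ Fin ν)) (x : Fin μ) :
    addPair (insertEquiv ν hι ha hb hab) α (Sum.inl (ι x)) = Sum.map ι id (α (Sum.inl x)) :=
  addPair_inl (insertEquiv ν hι ha hb hab) α (Sum.inl x)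

theorem addPair_insertEquiv_inr (α : Perm (Fin μ ⊕ Fin ν)) (x : Fin ν) :
    addPair (insertEquiv ν hι ha hb hab) α (Sum.inr x) = Sum.map ι id (α (Sum.inr x)) :=
  addPair_inl (insertEquiv ν hι ha hb hab) α (Sum.inr x)

theorem addPair_insertEquiv_left (α : Perm (Fin μ ⊕ Fin ν)) :
    addPair (insertEquiv ν hι ha hb hab) α (Sum.inl a) = Sum.inl b :=
  addPair_inr (insertEquiv ν hι ha hb hab) α false

theorem addPair_insertEquiv_right (α : Perm (Fin μ ⊕ Fin ν)) :
    addPair (insertEquiv ν hι ha hb hab) α (Sum.inl b) = Sum.inl a :=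
  addPair_inr (insertEquiv ν hι ha hb hab) α true

/-- Two more points and one more face leave the planarity relation intact, and the new points, being
paired with each other, cannot link the circles. -/
theorem isAnnular_addPair {z : Fin μ} (h₁ : finRotate (μ + 2) a = b)
    (h₂ : finRotate (μ + 2) b = ι z)
    (h₃ : ∀ x, finRotate (μ + 2) (ι x) = if finRotate μ x = z then a else ι (finRotate μ x))
    (α : Perm (Fin μ ⊕ Fin ν)) :
    IsAnnular (addPair (insertEquiv ν hι ha hb hab) α) ↔ IsAnnular α := by
  have hlink : (∃ i j, addPair (insertEquiv ν hι ha hb hab) α (Sum.inl i) = Sum.inr j) ↔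
      ∃ i j, α (Sum.inl i) = Sum.inr j := by
    constructor
    · rintro ⟨i, j, hij⟩
      obtain ⟨x, hx⟩ := (insertEquiv ν hι ha hb hab).surjective (Sum.inl i)
      rcases x with (x | x) | (_ | _)
      · rw [← hx, addPair_inl, insertEquiv_inl] at hij
        refine ⟨x, j, ?_⟩
        cases h : α (Sum.inl x) <;> simp_all
      · simp [insertEquiv_inl] at hx
      · rw [← hx, addPair_inr] at hij
        simp [insertEquiv_true] at hij
      · rw [← hx, addPair_inr] at hij
        simp [insertEquiv_false] at hij
    · rintro ⟨i, j, hij⟩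
      exact ⟨ι i, j, by simp [addPair_insertEquiv_inl, hij]⟩
  have hnum := numCycles_addPair (insertEquiv ν hι ha hb hab) (σ := circles (μ + 2) ν)
    (σ' := circles μ ν) (z := Sum.inl z) (by simp [insertEquiv_false, insertEquiv_true, h₁])
    (by simp [insertEquiv_inl, insertEquiv_true, h₂]) (by
      rintro (x | x)
      · simp only [insertEquiv_inl, Sum.map_inl, circles_inl, h₃, Sum.inl.injEq,
          insertEquiv_false]
        split_ifs <;> rfl
      · simp [insertEquiv_inl]) α
  constructor
  · rintro ⟨h1, h2, h3, h4⟩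
    exact ⟨(addPair_involutive _).1 h1, (addPair_fixedPointFree _).1 h2, hlink.1 h3, by
      rw [hnum] at h4; omega⟩
  · rintro ⟨h1, h2, h3, h4⟩
    exact ⟨(addPair_involutive _).2 h1, (addPair_fixedPointFree _).2 h2, hlink.2 h3, by
      rw [hnum]; omega⟩

theorem count_insert {z : Fin μ} (h₁ : finRotate (μ + 2) a = b)
    (h₂ : finRotate (μ + 2) b = ι z)
    (h₃ : ∀ x, finRotate (μ + 2) (ι x) = if finRotate μ x = z then a else ι (finRotate μ x))
    {P : Perm (Fin μ ⊕ Fin ν) → Prop} {Q : Perm (Fin (μ + 2) ⊕ Fin ν) → Prop}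
    (hPQ : ∀ α, Q (addPair (insertEquiv ν hι ha hb hab) α) ↔ P α) :
    count (fun α : Perm (Fin (μ + 2) ⊕ Fin ν) =>
      (IsAnnular α ∧ Q α) ∧ α (Sum.inl a) = Sum.inl b) =
      count (fun α : Perm (Fin μ ⊕ Fin ν) => IsAnnular α ∧ P α) := by
  symm
  refine count_eq_of_bijOn (addPair (insertEquiv ν hι ha hb hab)) (addPair_injective _)
    (fun α => ?_) ?_
  · rw [isAnnular_addPair hι ha hb hab h₁ h₂ h₃, hPQ]
    simp [addPair_insertEquiv_left]
  · rintro β ⟨⟨h, -⟩, hβ⟩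
    exact exists_addPair _ h.involutive hβ

end Insert

theorem not_isAnnular_zero {ν : ℕ} (α : Perm (Fin 0 ⊕ Fin ν)) : ¬ IsAnnular α :=
  fun h => h.link.choose.elim0

theorem not_isAnnular_two {ν : ℕ} {α : Perm (Fin 2 ⊕ Fin ν)} {a b : Fin 2} (hab : a ≠ b)
    (h : α (Sum.inl a) = Sum.inl b) : ¬ IsAnnular α := by
  rintro ⟨h1, -, ⟨i, j, hij⟩, -⟩
  have h' : α (Sum.inl b) = Sum.inl a := by rw [← h, h1]
  have : i = a ∨ i = b := by omega
  rcases this with rfl | rfl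
  · rw [h] at hij; cases hij
  · rw [h'] at hij; cases hij

/-! ### Recurrences from deleting a pair of neighbours. -/

/-- The number of reduced annular pairings. -/
noncomputable def reducedCount (t : Prop) (p μ ν : ℕ) : ℕ :=
  count (fun α : Perm (Fin μ ⊕ Fin ν) => IsAnnular α ∧ Reduced t p α)

/-- The number of cyclically reduced annular pairings. -/
noncomputable def cyclicCount (t : Prop) (μ ν : ℕ) : ℕ :=
  count (fun α : Perm (Fin μ ⊕ Fin ν) => IsAnnular α ∧ CyclicallyReduced t α)

theorem reducedCount_zero (t : Prop) (p ν : ℕ) : reducedCount t p 0 ν = 0 :=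
  count_eq_zero fun α h => not_isAnnular_zero α h.1

theorem reducedCount_one (t : Prop) (μ ν : ℕ) : reducedCount t 1 μ ν = reducedCount t 0 μ ν :=
  count_congr fun α => and_congr_right fun _ => and_congr_left fun _ =>
    ⟨fun _ i j _ hj => by omega, fun _ i j hij hj => by omega⟩

theorem sum_map_eq_inr_iff {μ ν : ℕ} {ι : Fin μ → Fin (μ + 2)} (x : Fin μ ⊕ Fin ν) (y : Fin ν) :
    Sum.map ι id x = Sum.inr y ↔ x = Sum.inr y := by
  cases x <;> simp

theorem sum_map_eq_inl_iff {μ ν : ℕ} {ι : Fin μ → Fin (μ + 2)} (hι : Function.Injective ι)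
    (x : Fin μ ⊕ Fin ν) (y : Fin μ) :
    Sum.map ι id x = Sum.inl (ι y) ↔ x = Sum.inl y := by
  cases x <;> simp [hι.eq_iff]

/-- Split according to whether the points `p` and `p + 1` (counted from 0) are paired. If they are,
delete them: only the conditions among the first `p` points survive, since the condition on `p - 1`
and `p` holds automatically. -/
theorem reducedCount_succ (t : Prop) {p μ : ℕ} (hp : p ≤ μ) (ν : ℕ) :
    reducedCount t (p + 1) (μ + 2) ν =
      reducedCount t (p + 2) (μ + 2) ν + reducedCount t p μ ν := by
  let a : Fin (μ + 2) := ⟨p, by omega⟩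
  let b : Fin (μ + 2) := ⟨p + 1, by omega⟩
  have hab : a ≠ b := by simp [a, b]
  unfold reducedCount
  rw [count_split (H := Fin (μ + 2) ⊕ Fin ν) _ (fun α => α (Sum.inl a) = Sum.inl b)]
  congr 1
  · refine count_congr fun α => ?_
    rw [and_assoc]
    refine and_congr_right fun _ => ?_
    constructor
    · rintro ⟨⟨h1, h2⟩, h3⟩
      refine ⟨fun i j hij hj => ?_, h2⟩
      by_cases hjp : (j : ℕ) < p + 1
      · exact h1 i j hij hjp
      · obtain rfl : i = a := Fin.ext (by simp only [a]; omega)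
        obtain rfl : j = b := Fin.ext (by simp only [b]; omega)
        exact h3
    · rintro ⟨h1, h2⟩
      exact ⟨⟨fun i j hij hj => h1 i j hij (by omega), h2⟩, h1 a b rfl (by simp [b])⟩
  -- For `μ = 0` there is no successor `z` of the inserted pair; both counts vanish because no point
  -- is left to link the circles.
  · rcases Nat.eq_zero_or_pos μ with rfl | hμ
    · rw [count_eq_zero fun α h => not_isAnnular_two hab h.2 h.1.1,
        count_eq_zero fun α h => not_isAnnular_zero α h.1]
    let ι : Fin μ → Fin (μ + 2) := fun i => ⟨if (i : ℕ) < p then i else i + 2, by split_ifs <;> omega⟩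
    have hv : ∀ i, (ι i : ℕ) = if (i : ℕ) < p then (i : ℕ) else i + 2 := fun i => rfl
    have hι : Function.Injective ι := fun x y h => by
      have := congrArg Fin.val h
      rw [hv, hv] at this
      exact Fin.ext (by split_ifs at this <;> omega)
    have ha : ∀ i, ι i ≠ a := fun i h => by
      have := congrArg Fin.val h
      rw [hv] at this
      simp only [a] at this
      split_ifs at this <;> omega
    have hb : ∀ i, ι i ≠ b := fun i h => by
      have := congrArg Fin.val h
      rw [hv] at this
      simp only [b] at this
      split_ifs at this <;> omega
    -- The old point following the inserted pair; for `p = μ` the pair comes last and the circle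
    -- wraps around to 0.
    let z : Fin μ := ⟨if p < μ then p else 0, by split_ifs <;> omega⟩
    refine count_insert hι ha hb hab (z := z) ?_ ?_ ?_ fun α => ?_
    · apply Fin.ext
      rw [finRotate_val]
      simp only [a, b]
      split_ifs <;> omega
    · apply Fin.ext
      rw [finRotate_val, hv]
      simp only [b, z]
      split_ifs <;> omega
    · intro x
      have hx := x.2
      have hiff : finRotate μ x = z ↔ (p < μ ∧ (x : ℕ) + 1 ≠ μ ∧ (x : ℕ) + 1 = p) ∨
          ((p = 0 ∨ p = μ) ∧ (x : ℕ) + 1 = μ) := by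
        rw [Fin.ext_iff, finRotate_val]
        simp only [z]
        constructor
        · intro h
          split_ifs at h <;> omega
        · intro h
          split_ifs <;> omega
      apply Fin.ext
      rw [finRotate_val, apply_ite Fin.val, hv, hv, finRotate_val]
      simp only [hiff, a]
      split_ifs <;> omega
    · refine and_congr ?_ ?_
      · constructor
        · intro h i j hij hj h'
          refine h (ι i) (ι j) ?_ ?_ ?_
          · rw [hv, hv]; split_ifs <;> omega
          · rw [hv]; split_ifs; omega
          · rw [addPair_insertEquiv_inl, h', Sum.map_inl]
        · intro h i j hij hj h'
          by_cases hjp : (j : ℕ) < p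
          · obtain ⟨i, rfl⟩ : ∃ i', i = ι i' :=
              ⟨⟨i, by omega⟩, Fin.ext (by rw [hv]; simp; omega)⟩
            obtain ⟨j, rfl⟩ : ∃ j', j = ι j' :=
              ⟨⟨j, by omega⟩, Fin.ext (by rw [hv]; simp; omega)⟩
            rw [addPair_insertEquiv_inl, sum_map_eq_inl_iff hι] at h'
            rw [hv] at hjp
            rw [hv, hv] at hij
            exact h i j (by split_ifs at hij hjp <;> omega) (by split_ifs at hjp <;> omega) h'
          -- The partner of `a` is `b`, which lies after `a`, not before it.
          · obtain rfl : j = a := Fin.ext (by simp only [a]; omega)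
            rw [← addPair_insertEquiv_right hι ha hb hab α,
              (addPair _ α).injective.eq_iff] at h'
            have := congrArg Fin.val (Sum.inl_injective h')
            simp only [b] at this
            omega
      · refine forall_congr' fun _ => forall_congr' fun j => not_congr ?_
        rw [addPair_insertEquiv_inr, sum_map_eq_inr_iff]

/-- Linear and cyclic reducedness differ only in the pair formed by the last and the first point.
Deleting it makes no two remaining points newly adjacent in the linear order. -/
theorem reducedCount_self (t : Prop) (μ ν : ℕ) :
    reducedCount t (μ + 2) (μ + 2) ν = cyclicCount t (μ + 2) ν + reducedCount t μ μ ν := by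
  let a : Fin (μ + 2) := ⟨μ + 1, by omega⟩
  let b : Fin (μ + 2) := ⟨0, by omega⟩
  have hab : a ≠ b := by simp [a, b]
  unfold reducedCount cyclicCount
  rw [count_split (H := Fin (μ + 2) ⊕ Fin ν) _ (fun α => α (Sum.inl a) = Sum.inl b)]
  congr 1
  · refine count_congr fun α => ?_
    rw [and_assoc]
    refine and_congr_right fun _ => ?_
    constructor
    · rintro ⟨⟨h1, h2⟩, h3⟩
      refine ⟨fun i => ?_, h2⟩
      have hi := finRotate_val i
      by_cases hia : (i : ℕ) + 1 = μ + 2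
      · rw [if_pos hia] at hi
        obtain rfl : i = a := Fin.ext (by simp only [a]; omega)
        rwa [show finRotate (μ + 2) a = b from Fin.ext hi]
      · rw [if_neg hia] at hi
        exact h1 _ _ hi.symm (Fin.is_lt _)
    · rintro ⟨h1, h2⟩
      refine ⟨⟨fun i j hij hj => ?_, h2⟩, ?_⟩
      · rw [show j = finRotate (μ + 2) i from Fin.ext (by rw [finRotate_val]; split_ifs <;> omega)]
        exact h1 i
      · rw [show b = finRotate (μ + 2) a from Fin.ext (by rw [finRotate_val]; simp [a, b])]
        exact h1 a
  · rcases Nat.eq_zero_or_pos μ with rfl | hμ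
    · rw [count_eq_zero fun α h => not_isAnnular_two hab h.2 h.1.1,
        count_eq_zero fun α h => not_isAnnular_zero α h.1]
    let ι : Fin μ → Fin (μ + 2) := fun i => ⟨i + 1, by omega⟩
    have hv : ∀ i, (ι i : ℕ) = i + 1 := fun i => rfl
    have hι : Function.Injective ι := fun x y h => by
      have := congrArg Fin.val h
      rw [hv, hv] at this
      exact Fin.ext (by omega)
    have ha : ∀ i, ι i ≠ a := fun i h => by
      have := congrArg Fin.val h
      rw [hv] at this
      simp only [a] at this
      omega
    have hb : ∀ i, ι i ≠ b := fun i h => by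
      have := congrArg Fin.val h
      rw [hv] at this
      simp only [b] at this
      omega
    refine count_insert hι ha hb hab (z := ⟨0, hμ⟩) ?_ ?_ ?_ fun α => ?_
    · apply Fin.ext
      rw [finRotate_val]
      simp [a, b]
    · apply Fin.ext
      rw [finRotate_val, hv]
      simp [b]
    · intro x
      have hx := x.2
      have hiff : finRotate μ x = ⟨0, hμ⟩ ↔ (x : ℕ) + 1 = μ := by
        rw [Fin.ext_iff, finRotate_val]
        simp
      apply Fin.ext
      rw [finRotate_val, apply_ite Fin.val, hv, hv, finRotate_val]
      simp only [hiff, a]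
      split_ifs <;> omega
    · have hl := addPair_insertEquiv_left (ν := ν) hι ha hb hab α
      have hr := addPair_insertEquiv_right (ν := ν) hι ha hb hab α
      refine and_congr ?_ ?_
      · constructor
        · intro h i j hij hj h'
          refine h (ι i) (ι j) ?_ ?_ ?_
          · rw [hv, hv]; omega
          · exact Fin.is_lt _
          · rw [addPair_insertEquiv_inl, h', Sum.map_inl]
        · intro h i j hij hj h'
          by_cases hi0 : (i : ℕ) = 0
          · obtain rfl : i = b := Fin.ext hi0
            rw [hr] at h'
            have := congrArg Fin.val (Sum.inl_injective h')
            simp only [a, b] at this hij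
            omega
          by_cases hja : (j : ℕ) = μ + 1
          · obtain rfl : j = a := Fin.ext hja
            rw [← hr, (addPair _ α).injective.eq_iff] at h'
            have := congrArg Fin.val (Sum.inl_injective h')
            simp only [b] at this
            omega
          obtain ⟨i, rfl⟩ : ∃ i', i = ι i' :=
            ⟨⟨i - 1, by omega⟩, Fin.ext (by rw [hv]; simp; omega)⟩
          obtain ⟨j, rfl⟩ : ∃ j', j = ι j' :=
            ⟨⟨j - 1, by omega⟩, Fin.ext (by rw [hv]; simp; omega)⟩
          rw [addPair_insertEquiv_inl, sum_map_eq_inl_iff hι] at h'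
          rw [hv, hv] at hij
          exact h i j (by omega) j.2 h'
      · refine forall_congr' fun _ => forall_congr' fun j => not_congr ?_
        rw [addPair_insertEquiv_inr, sum_map_eq_inr_iff]

/-- On a circle with one point, that point is its own neighbour, and fixed points are excluded
anyway. -/
theorem cyclicCount_one (t : Prop) (ν : ℕ) : cyclicCount t 1 ν = reducedCount t 1 1 ν := by
  refine count_congr fun α => and_congr_right fun h => and_congr_left fun _ => ?_
  constructor
  · intro _ i j hij
    omega
  · intro _ i h'
    rw [Subsingleton.elim (finRotate 1 i) i] at h'
    exact h.fixedPointFree _ h'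

/-! ### Solving the recurrence by a reflection principle. -/

section Inversion

/-- Extension of a sequence on `ℕ` to `ℤ` that is antisymmetric about `-1`. -/
def reflectExtend (w : ℕ → ℤ) (k : ℤ) : ℤ :=
  if 0 ≤ k then w k.toNat else if k = -1 then 0 else - w (-k - 2).toNat

theorem reflectExtend_natCast (w : ℕ → ℤ) (k : ℕ) : reflectExtend w k = w k := by
  simp [reflectExtend]

theorem reflectExtend_neg (w : ℕ → ℤ) (k : ℤ) :
    reflectExtend w (-k - 2) = - reflectExtend w k := by
  unfold reflectExtend
  split_ifs <;> first | omega | simp_all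

/-- The binomial transform along steps of length two. -/
def binomialShift (u : ℤ → ℤ) (q : ℕ) (k : ℤ) : ℤ :=
  ∑ s ∈ Finset.range (q + 1), (q.choose s : ℤ) * u (k - 2 * s)

theorem binomialShift_succ (u : ℤ → ℤ) (q : ℕ) (k : ℤ) :
    binomialShift u (q + 1) k = binomialShift u q k + binomialShift u q (k - 2) := by
  unfold binomialShift
  have := Finset.sum_choose_succ_mul (fun i _ => u (k - 2 * i)) q
  rw [this, add_comm]
  rw [add_comm]
  congr 1
  refine Finset.sum_congr rfl fun s _ => ?_
  congr 2
  push_cast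
  ring

theorem binomialShift_reflect (u : ℤ → ℤ) (q : ℕ) (k : ℤ) :
    binomialShift u q k = binomialShift (fun j => u (-j)) q (2 * q - k) := by
  unfold binomialShift
  rw [← Finset.sum_range_reflect]
  refine Finset.sum_congr rfl fun s hs => ?_
  have hs : s ≤ q := Nat.lt_succ_iff.1 (Finset.mem_range.1 hs)
  rw [show q + 1 - 1 - s = q - s by omega, Nat.choose_symm hs]
  congr 2
  push_cast [hs]
  ring

theorem sum_range_eq_two_mul_of_reflect {g : ℕ → ℤ} {n : ℕ}
    (hg : ∀ s, s ≤ n → g (n - s) = g s) (hmid : ∀ s, 2 * s = n → g s = 0) :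
    ∑ s ∈ Finset.range (n + 1), g s = 2 * ∑ s ∈ Finset.range ((n + 1) / 2), g s := by
  have key : ∀ h r, h + r + h = n + 1 → r ≤ 1 →
      ∑ s ∈ Finset.range (n + 1), g s = 2 * ∑ s ∈ Finset.range h, g s := by
    intro h r hn hr
    rw [← hn, Finset.sum_range_add, Finset.sum_range_add]
    have h1 : ∑ x ∈ Finset.range r, g (h + x) = 0 :=
      Finset.sum_eq_zero fun x hx => hmid _ (by have := Finset.mem_range.1 hx; omega)
    have h2 : ∑ x ∈ Finset.range h, g (h + r + x) = ∑ s ∈ Finset.range h, g s := by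
      rw [← Finset.sum_range_reflect]
      refine Finset.sum_congr rfl fun x hx => ?_
      have := Finset.mem_range.1 hx
      rw [← hg x (by omega)]
      congr 1
      omega
    rw [h1, h2]
    ring
  exact key _ ((n + 1) % 2) (by omega) (by omega)

/-- By `h_succ` and Pascal's rule, `M p (p + q)` is a binomial sum of diagonal values `u k = M k k`.
The boundary condition `h_one` is met by extending `u` to `ℤ` antisymmetrically about `-1`. By
`h_self`, differences of `u` with step two are the values of `c`. -/
theorem reduced_eq_sum_cyclic {M : ℕ → ℕ → ℤ} {c : ℕ → ℤ} (h_zero : ∀ p, M p 0 = 0)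
    (h_one : ∀ n, M 1 n = M 0 n)
    (h_succ : ∀ p n, p ≤ n → M (p + 1) (n + 2) = M (p + 2) (n + 2) + M p n)
    (h_self : ∀ n, M (n + 2) (n + 2) = c (n + 2) + M n n) (h_c : c 1 = M 1 1) (n : ℕ) :
    M 0 n = ∑ m ∈ Finset.range ((n + 1) / 2), (n.choose m : ℤ) * c (n - 2 * m) := by
  set u := reflectExtend (fun k => M k k) with hu
  have hneg : ∀ k, u (-k - 2) = - u k := reflectExtend_neg _
  have hnat : ∀ k : ℕ, u k = M k k := reflectExtend_natCast _
  -- The arguments `q - 1 - 2s` are symmetric about `-1`, so the terms `s` and `q - s` cancel. This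
  -- is the extra Pascal term at `p = 0`, where `h_one` has none.
  have hvanish : ∀ q : ℕ, binomialShift u q (q - 1) = 0 := by
    intro q
    have h := binomialShift_reflect u q (q - 1)
    have h2 : binomialShift (fun j => u (-j)) q (2 * q - (q - 1)) =
        - binomialShift u q (q - 1) := by
      unfold binomialShift
      rw [← Finset.sum_neg_distrib]
      refine Finset.sum_congr rfl fun s _ => ?_
      rw [← mul_neg, ← hneg]
      refine congrArg _ (congrArg u ?_)
      ring
    omega
  have hM : ∀ q p : ℕ, M p (p + q) = binomialShift u q (p + q) := by
    intro q
    induction q with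
    | zero => intro p; simp [binomialShift, hnat]
    | succ q ih =>
      intro p
      rw [binomialShift_succ]
      cases p with
      | zero =>
        rw [← h_one, show 0 + (q + 1) = 1 + q by omega, ih 1]
        have := hvanish q
        rw [show ((0 : ℕ) : ℤ) + ((q + 1 : ℕ) : ℤ) - 2 = q - 1 by push_cast; ring, this, add_zero]
        congr 1
        push_cast
        ring
      | succ p =>
        rw [show p + 1 + (q + 1) = (p + q) + 2 by omega, h_succ p _ (by omega),
          show p + q + 2 = p + 2 + q by omega, ih, ih]
        congr 2 <;> push_cast <;> ring
  have hM0 := hM n 0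
  rw [Nat.zero_add, Nat.cast_zero, zero_add] at hM0
  set v : ℤ → ℤ := fun k => u k - u (k - 2) with hv
  -- Adding the sum to its reflection turns `u` into its difference `v`, which is even; the terms
  -- `s` and `n - s` then agree and half of them suffice.
  have hdouble : 2 * M 0 n =
      ∑ s ∈ Finset.range (n + 1), (n.choose s : ℤ) * v (n - 2 * s) := by
    have h := binomialShift_reflect u n n
    rw [two_mul]
    nth_rewrite 2 [hM0]
    rw [h, hM0]
    unfold binomialShift
    rw [← Finset.sum_add_distrib]
    refine Finset.sum_congr rfl fun s _ => ?_
    have := hneg ((n : ℤ) - 2 * s - 2)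
    rw [show -((n : ℤ) - 2 * s - 2) - 2 = -(2 * n - n - 2 * s) by ring] at this
    beta_reduce
    simp only [this, hv]
    ring
  have hv_symm : ∀ k, v (-k) = v k := fun k => by
    have h1 := hneg k
    have h2 := hneg (k - 2)
    rw [show -(k - 2) - 2 = -k by ring] at h2
    simp only [hv, h1, h2]
    ring
  -- Antisymmetry gives `v 0 = 2 u 0`, and `u 0 = M 0 0 = 0`. This removes the middle term for even
  -- `n`.
  have hv_zero : v 0 = 0 := by
    have h1 := hneg 0
    have h2 := hnat 0
    rw [h_zero] at h2
    simp only [Nat.cast_zero] at h2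
    simp only [hv]
    rw [h2] at h1 ⊢
    simpa using h1
  have hv_pos : ∀ k : ℕ, 0 < k → v k = c k := by
    intro k hk
    obtain rfl | ⟨k, rfl⟩ : k = 1 ∨ ∃ j, k = j + 2 := by
      rcases k with _ | _ | k
      · omega
      · exact Or.inl rfl
      · exact Or.inr ⟨k, rfl⟩
    · have h1 : u (-1) = 0 := by simp [hu, reflectExtend]
      simp only [hv, hnat, h_c]
      norm_num [h1]
    · simp only [hv, hnat, h_self]
      rw [show ((k + 2 : ℕ) : ℤ) - 2 = k by push_cast; ring, hnat]
      ring
  rw [sum_range_eq_two_mul_of_reflect] at hdouble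
  · rw [mul_left_cancel₀ two_ne_zero hdouble]
    refine Finset.sum_congr rfl fun m hm => ?_
    have hm := Finset.mem_range.1 hm
    rw [← hv_pos _ (by omega)]
    push_cast [show 2 * m ≤ n by omega]
    rfl
  · intro s hs
    rw [Nat.choose_symm hs, ← hv_symm]
    congr 2
    push_cast [hs]
    ring
  · intro s hs
    rw [show (n : ℤ) - 2 * s = 0 by omega, hv_zero, mul_zero]

end Inversion

theorem reducedCount_eq_sum (t : Prop) (μ ν : ℕ) :
    reducedCount t 0 μ ν =
      ∑ m ∈ Finset.range ((μ + 1) / 2), μ.choose m * cyclicCount t (μ - 2 * m) ν := by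
  have := reduced_eq_sum_cyclic (M := fun p n => (reducedCount t p n ν : ℤ))
    (c := fun n => (cyclicCount t n ν : ℤ)) (fun p => by simp [reducedCount_zero])
    (fun n => by simp [reducedCount_one])
    (fun p n h => by exact_mod_cast reducedCount_succ t h ν)
    (fun n => by exact_mod_cast reducedCount_self t n ν)
    (by exact_mod_cast cyclicCount_one t ν) μ
  exact_mod_cast this

/-! ### Exchanging the two circles. -/

section Swap

variable {μ ν : ℕ}

theorem permCongr_sumComm_inl (α : Perm (Fin μ ⊕ Fin ν)) (j : Fin ν) :
    (Equiv.sumComm _ _).permCongr α (Sum.inl j) = (α (Sum.inr j)).swap := rfl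

theorem permCongr_sumComm_inr (α : Perm (Fin μ ⊕ Fin ν)) (i : Fin μ) :
    (Equiv.sumComm _ _).permCongr α (Sum.inr i) = (α (Sum.inl i)).swap := rfl

theorem IsAnnular.swap {α : Perm (Fin μ ⊕ Fin ν)} (h : IsAnnular α) :
    IsAnnular ((Equiv.sumComm _ _).permCongr α) where
  involutive x := by simp [Equiv.permCongr_apply, h.involutive]
  fixedPointFree x := by
    rw [Equiv.permCongr_apply, Ne, ← Equiv.eq_symm_apply]
    exact h.fixedPointFree _
  link := by
    obtain ⟨i, j, hij⟩ := h.link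
    refine ⟨j, i, ?_⟩
    rw [permCongr_sumComm_inl, ← hij, h.involutive]
    rfl
  planar := by
    rw [add_comm, ← h.planar]
    congr 1
    symm
    refine numCycles_conj (Equiv.sumComm _ _) fun x => ?_
    have : ∀ y, (circles μ ν)⁻¹ y = Sum.swap ((circles ν μ)⁻¹ (Sum.swap y)) := by
      rintro (y | y) <;> rfl
    simp [Equiv.permCongr_apply]
    cases h : α x <;> rfl

theorem isAnnular_swap_iff {α : Perm (Fin μ ⊕ Fin ν)} :
    IsAnnular ((Equiv.sumComm _ _).permCongr α) ↔ IsAnnular α := by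
  refine ⟨fun h => ?_, IsAnnular.swap⟩
  have := h.swap
  convert this using 1
  ext x
  simp [Equiv.permCongr_apply]

theorem sum_swap_eq_iff {A B : Type*} (x : A ⊕ B) (y : B ⊕ A) : x.swap = y ↔ x = y.swap := by
  cases x <;> cases y <;> simp

/-- After the exchange, the condition on the treated circle moves into the flag `t`, and the
recurrence can be run on the other circle while keeping it. -/
theorem cyclicCount_false : cyclicCount False μ ν = reducedCount True 0 ν μ := by
  refine count_eq_of_bijOn _ ((Equiv.sumComm (Fin μ) (Fin ν)).permCongr).injective
    (fun α => ?_) fun β _ => Equiv.surjective _ β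
  rw [isAnnular_swap_iff]
  refine and_congr_right fun _ => ?_
  constructor
  · rintro ⟨-, h⟩
    refine ⟨fun i hi => h trivial i ?_, False.elim⟩
    rw [permCongr_sumComm_inr, hi]
    rfl
  · rintro ⟨h, -⟩
    refine ⟨fun i j _ hj => absurd hj (Nat.not_lt_zero _), fun _ i hi => h i ?_⟩
    rw [permCongr_sumComm_inr, sum_swap_eq_iff] at hi
    exact hi

end Swap

/-! ### Pairings in which no neighbours are paired. -/

section Cycles

variable {H : Type*} [Fintype H] {φ : Perm H}

/-- Without fixed points every cycle has at least two elements, so equality of the totals forces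
every cycle to have exactly two. -/
theorem two_mul_numCycles_eq_iff (hφ : ∀ x, φ x ≠ x) :
    2 * numCycles φ = Fintype.card H ↔ ∀ x, φ (φ x) = x := by
  classical
  let s := Perm.SameCycle.setoid φ
  let F : Quotient s → Finset H := fun q => Finset.univ.filter fun x => Quotient.mk s x = q
  have hmem : ∀ x y, y ∈ F (Quotient.mk s x) ↔ φ.SameCycle y x := fun x y => by
    simp only [F, Finset.mem_filter, Finset.mem_univ, true_and]
    exact Quotient.eq (r := s)
  have hsub : ∀ x, {x, φ x} ⊆ F (Quotient.mk s x) := fun x y hy => by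
    rw [hmem]
    simp only [Finset.mem_insert, Finset.mem_singleton] at hy
    rcases hy with rfl | rfl
    · exact Perm.SameCycle.refl _ _
    · exact Perm.sameCycle_apply_left.2 (Perm.SameCycle.refl _ _)
  have hpair : ∀ x, ({x, φ x} : Finset H).card = 2 := fun x => Finset.card_pair (hφ x).symm
  have hge : ∀ q ∈ Finset.univ, 2 ≤ (F q).card := fun q _ => by
    induction q using Quotient.inductionOn with
    | h x => exact (hpair x).symm.le.trans (Finset.card_le_card (hsub x))
  have hsum : Fintype.card H = ∑ q, (F q).card :=
    Finset.card_eq_sum_card_fiberwise (f := Quotient.mk s) (fun _ _ => Finset.mem_coe.2 (Finset.mem_univ _))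
  have htwo : 2 * numCycles φ = ∑ _q : Quotient s, 2 := by
    rw [Finset.sum_const, Finset.card_univ, numCycles, Nat.card_eq_fintype_card, smul_eq_mul,
      mul_comm]
  rw [hsum, htwo, Finset.sum_eq_sum_iff_of_le hge]
  constructor
  · intro h x
    have heq : {x, φ x} = F (Quotient.mk s x) := Finset.eq_of_subset_of_card_le (hsub x)
      (by rw [hpair, ← h _ (Finset.mem_univ _)])
    have : φ (φ x) ∈ F (Quotient.mk s x) := (hmem _ _).2
      (Perm.sameCycle_apply_left.2 (Perm.sameCycle_apply_left.2 (Perm.SameCycle.refl _ _)))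
    rw [← heq] at this
    simpa [hφ] using this
  · intro h q _
    induction q using Quotient.inductionOn with
    | h x =>
      rw [← hpair x]
      congr 1
      refine (hsub x).antisymm fun y hy => ?_
      have := eq_of_sameCycle (r := fun y => ({y, φ y} : Finset H)) (fun y => by
        rw [h, Finset.pair_comm]) ((hmem _ _).1 hy)
      rw [← this]
      simp

end Cycles

section Base

/-- The reflection that exchanges two circles of the same length. -/
def reflection {m : ℕ} (c : Fin (m + 1)) : Perm (Fin (m + 1) ⊕ Fin (m + 1)) :=
  Function.Involutive.toPerm (Sum.elim (fun i => Sum.inr (c - i)) fun j => Sum.inl (c - j))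
    (by rintro (x | x) <;> simp)

@[simp] theorem reflection_inl {m : ℕ} (c i : Fin (m + 1)) :
    reflection c (Sum.inl i) = Sum.inr (c - i) := rfl

@[simp] theorem reflection_inr {m : ℕ} (c i : Fin (m + 1)) :
    reflection c (Sum.inr i) = Sum.inl (c - i) := rfl

theorem reflection_injective {m : ℕ} : Function.Injective (reflection (m := m)) := by
  intro c d h
  have := congrArg (fun f => f (Sum.inl 0)) h
  simpa using this

variable {μ ν : ℕ} {α : Perm (Fin μ ⊕ Fin ν)}

theorem circles_inv_inl {m : ℕ} (i : Fin (m + 1)) :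
    (circles (m + 1) ν)⁻¹ (Sum.inl i) = Sum.inl (i - 1) := by
  rw [Perm.inv_eq_iff_eq, circles_inl, finRotate_apply, sub_add_cancel]

theorem circles_inv_inr {m : ℕ} (j : Fin (m + 1)) :
    (circles μ (m + 1))⁻¹ (Sum.inr j) = Sum.inr (j - 1) := by
  rw [Perm.inv_eq_iff_eq, circles_inr, finRotate_apply, sub_add_cancel]

/-- A fixed point of `σ⁻¹ α` would be a point paired with its successor. So there is none, planarity
makes `σ⁻¹ α` an involution, and hence `α` conjugates the rotation to its inverse. -/
theorem apply_circles_of_reduced (h : IsAnnular α) (hr : CyclicallyReduced True α)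
    (x : Fin μ ⊕ Fin ν) : α (circles μ ν x) = (circles μ ν)⁻¹ (α x) := by
  have hfix : ∀ x, ((circles μ ν)⁻¹ * α) x ≠ x := by
    intro x hx
    rw [Perm.mul_apply, Perm.inv_eq_iff_eq] at hx
    rcases x with i | j
    · exact hr.1 i hx
    · exact hr.2 trivial j hx
  have := (two_mul_numCycles_eq_iff hfix).1 (by rw [h.planar]; simp) x
  rw [Perm.mul_apply, Perm.mul_apply, Perm.inv_eq_iff_eq] at this
  rw [← h.involutive ((circles μ ν)⁻¹ (α x)), ← this]

/-- Since `α` reverses the rotation, one link propagates step by step around the whole first circle.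
-/
theorem exists_apply_inl_of_reduced (h : IsAnnular α) (hr : CyclicallyReduced True α)
    (i : Fin μ) : ∃ j, α (Sum.inl i) = Sum.inr j := by
  obtain ⟨i₀, j₀, h₀⟩ := h.link
  obtain ⟨m, rfl⟩ : ∃ m, μ = m + 1 := ⟨μ - 1, by have := i.2; omega⟩
  have step : ∀ k : ℕ, ∃ j, α (Sum.inl (i₀ + Fin.ofNat (m + 1) k)) = Sum.inr j := by
    intro k
    induction k with
    | zero => exact ⟨j₀, by simpa using h₀⟩
    | succ k ih =>
      obtain ⟨j, hj⟩ := ih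
      have := apply_circles_of_reduced h hr (Sum.inl (i₀ + Fin.ofNat (m + 1) k))
      rw [hj, circles_inl, finRotate_apply] at this
      refine ⟨(finRotate ν).symm j, ?_⟩
      rw [show i₀ + Fin.ofNat (m + 1) (k + 1) = i₀ + Fin.ofNat (m + 1) k + 1 by
        rw [add_assoc]; congr 1; ext; simp [Fin.val_add], this]
      rfl
  have := step (i - i₀ : Fin (m + 1)).val
  rwa [show Fin.ofNat (m + 1) (i - i₀ : Fin (m + 1)).val = i - i₀ from Fin.ext (by simp),
    add_sub_cancel] at this

theorem CyclicallyReduced.swap (hr : CyclicallyReduced True α) :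
    CyclicallyReduced True ((Equiv.sumComm _ _).permCongr α) := by
  refine ⟨fun i hi => hr.2 trivial i ?_, fun _ i hi => hr.1 i ?_⟩
  · rwa [permCongr_sumComm_inl, sum_swap_eq_iff] at hi
  · rwa [permCongr_sumComm_inr, sum_swap_eq_iff] at hi

theorem le_of_reduced (h : IsAnnular α) (hr : CyclicallyReduced True α) : μ ≤ ν := by
  choose f hf using exists_apply_inl_of_reduced h hr
  have : Function.Injective f := fun x y hxy => by
    have := (hf x).trans ((congrArg Sum.inr hxy).trans (hf y).symm)
    exact Sum.inl_injective (α.injective this)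
  simpa using Fintype.card_le_of_injective f this

theorem eq_of_reduced (h : IsAnnular α) (hr : CyclicallyReduced True α) : μ = ν :=
  (le_of_reduced h hr).antisymm (le_of_reduced h.swap hr.swap)

/-- Reversing the rotation means `f (i + 1) = f i - 1`, so the image of 0 determines everything. -/
theorem exists_reflection_of_reduced {m : ℕ} {α : Perm (Fin (m + 1) ⊕ Fin (m + 1))}
    (h : IsAnnular α) (hr : CyclicallyReduced True α) : ∃ c, reflection c = α := by
  choose f hf using exists_apply_inl_of_reduced h hr
  have hstep : ∀ i, f (i + 1) = f i - 1 := fun i => by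
    have := apply_circles_of_reduced h hr (Sum.inl i)
    rw [hf, circles_inl, finRotate_apply, hf, circles_inv_inr] at this
    exact Sum.inr_injective this
  have hf' : ∀ k : ℕ, f (Fin.ofNat (m + 1) k) = f 0 - Fin.ofNat (m + 1) k := by
    intro k
    induction k with
    | zero => simp
    | succ k ih =>
      rw [show Fin.ofNat (m + 1) (k + 1) = Fin.ofNat (m + 1) k + 1 by
        ext; simp [Fin.val_add], hstep, ih]
      abel
  have hf'' : ∀ i, f i = f 0 - i := fun i => by
    have := hf' i
    rwa [show Fin.ofNat (m + 1) (i : ℕ) = i from Fin.ext (by simp)] at this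
  refine ⟨f 0, Equiv.ext ?_⟩
  rintro (i | j)
  · rw [hf, hf'' i, reflection_inl]
  · rw [reflection_inr, ← h.involutive (Sum.inl _), hf, hf'', sub_sub_cancel]

theorem reflection_isAnnular {m : ℕ} (c : Fin (m + 1)) : IsAnnular (reflection c) where
  involutive x := by rcases x with x | x <;> simp
  fixedPointFree x := by rcases x with x | x <;> simp
  link := ⟨0, c, by simp⟩
  planar := by
    have key := two_mul_numCycles_eq_iff (φ := (circles (m + 1) (m + 1))⁻¹ * reflection c) ?_
    · rw [key.2]
      · simp
      · rintro (x | x) <;>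
          simp only [Perm.mul_apply, reflection_inl, reflection_inr, circles_inv_inl,
            circles_inv_inr] <;> congr 1 <;> abel
    · rintro (x | x) <;>
        simp only [Perm.mul_apply, reflection_inl, reflection_inr, circles_inv_inl,
          circles_inv_inr] <;> simp

theorem cyclicCount_true (μ ν : ℕ) : cyclicCount True μ ν = if μ = ν then μ else 0 := by
  split_ifs with h
  · subst h
    cases μ with
    | zero => exact count_eq_zero fun α h => not_isAnnular_zero α h.1
    | succ m =>
      have : ∀ α : Perm (Fin (m + 1) ⊕ Fin (m + 1)),
          IsAnnular α ∧ CyclicallyReduced True α ↔ α ∈ Set.range (reflection (m := m)) := by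
        refine fun α => ⟨fun h => exists_reflection_of_reduced h.1 h.2, ?_⟩
        rintro ⟨c, rfl⟩
        exact ⟨reflection_isAnnular c, fun i => by simp, fun _ j => by simp⟩
      rw [cyclicCount, count_congr this]
      exact (Nat.card_range_of_injective reflection_injective).trans (by simp)
  · exact count_eq_zero fun α hα => h (eq_of_reduced hα.1 hα.2)

/-- The number of annular pairings. -/
theorem count_isAnnular (μ ν : ℕ) :
    count (IsAnnular (μ := μ) (ν := ν)) = ∑ m ∈ Finset.range ((μ + 1) / 2),
      μ.choose m * ∑ m' ∈ Finset.range ((ν + 1) / 2),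
        ν.choose m' * if ν - 2 * m' = μ - 2 * m then ν - 2 * m' else 0 := by
  have : count (IsAnnular (μ := μ) (ν := ν)) = reducedCount False 0 μ ν :=
    count_congr fun α => ⟨fun h => ⟨h, fun i j _ hj => absurd hj (Nat.not_lt_zero _), False.elim⟩,
      And.left⟩
  rw [this, reducedCount_eq_sum]
  simp_rw [cyclicCount_false, reducedCount_eq_sum, cyclicCount_true]

end Base

/-! ### Cycles, connectedness and standard circles. -/

section Cycle

variable {H : Type*} [Finite H]

theorem pow_card_sameCycle (σ : Perm H) {h₀ : H} {s : Set H}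
    (hs : ∀ h, h ∈ s ↔ σ.SameCycle h₀ h) {n : ℕ} (hn : Nat.card s = n) :
    (σ ^ n) h₀ = h₀ ∧ (∀ h ∈ s, ∃ i : Fin n, (σ ^ (i : ℕ)) h₀ = h) := by
  set d := Function.minimalPeriod σ h₀ with hd
  have hpos : 0 < d := Function.minimalPeriod_pos_of_mem_periodicPts
    (Function.Injective.mem_periodicPts σ.injective h₀)
  have hpow : ∀ k : ℕ, (σ ^ k) h₀ = σ^[k] h₀ := fun k => by rw [Perm.iterate_eq_pow]
  have hsurj : ∀ h ∈ s, ∃ i : Fin d, (σ ^ (i : ℕ)) h₀ = h := fun h hh => by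
    obtain ⟨k, hk⟩ := ((hs h).1 hh).exists_nat_pow_eq
    refine ⟨⟨k % d, Nat.mod_lt _ hpos⟩, ?_⟩
    rw [← hk, hpow, hpow]
    exact Function.iterate_mod_minimalPeriod_eq
  have hbij : Function.Bijective
      (fun i : Fin d => (⟨(σ ^ (i : ℕ)) h₀, (hs _).2 ⟨i, rfl⟩⟩ : s)) := by
    refine ⟨fun i j hij => ?_, fun ⟨h, hh⟩ => ?_⟩
    · have := congrArg Subtype.val hij
      simp only [hpow] at this
      exact Fin.ext (Function.iterate_injOn_Iio_minimalPeriod i.2 j.2 this)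
    · obtain ⟨i, hi⟩ := hsurj h hh
      exact ⟨i, Subtype.ext hi⟩
  have hdn : d = n := by
    rw [← hn, ← Nat.card_eq_of_bijective _ hbij, Nat.card_eq_fintype_card, Fintype.card_fin]
  refine ⟨?_, by rwa [hdn] at hsurj⟩
  rw [← hdn, hpow]
  exact Function.iterate_minimalPeriod

end Cycle

section Connected

variable {H : Type*} {α σ : Perm H} {vert : H → Fin 2}

/-- If no edge joins the two vertices, `vert` is invariant under the whole group. Otherwise powers
of `σ` followed, if necessary, by the linking edge bring every half-edge to one base point. -/
theorem transitive_iff_exists_link (hsurj : Function.Surjective vert)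
    (hvert : ∀ h h', vert h = vert h' ↔ σ.SameCycle h h') (hα : ∀ h, α (α h) = h) :
    (∀ h h' : H, ∃ τ ∈ Subgroup.closure {α, σ}, τ h = h') ↔
      ∃ h, vert h = 0 ∧ vert (α h) = 1 := by
  have hασ : α ∈ Subgroup.closure {α, σ} := Subgroup.subset_closure (by simp)
  have hσσ : σ ∈ Subgroup.closure {α, σ} := Subgroup.subset_closure (by simp)
  constructor
  · intro h
    by_contra! hne
    have h0 : ∀ x, vert x = 0 → vert (α x) = 0 := fun x hx => by
      have := hne x hx
      omega
    have h1 : ∀ x, vert (α x) = vert x := fun x => by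
      by_cases hx : vert x = 0
      · rw [hx, h0 x hx]
      · have h2 : vert (α x) ≠ 0 := fun h3 => hx (by simpa [hα] using h0 _ h3)
        omega
    have h2 : ∀ τ ∈ Subgroup.closure {α, σ}, ∀ x, vert (τ x) = vert x := by
      intro τ hτ
      induction hτ using Subgroup.closure_induction with
      | mem τ hτ =>
        rcases hτ with rfl | rfl
        · exact h1
        · exact fun x => (hvert _ _).2 (Perm.sameCycle_apply_left.2 (Perm.SameCycle.refl _ _))
      | one => exact fun x => rfl
      | mul τ τ' _ _ h h' => exact fun x => by rw [Perm.mul_apply, h, h']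
      | inv τ _ h => exact fun x => by rw [← h (τ⁻¹ x), ← Perm.mul_apply, mul_inv_cancel, Perm.one_apply]
    obtain ⟨x, hx⟩ := hsurj 0
    obtain ⟨y, hy⟩ := hsurj 1
    obtain ⟨τ, hτ, rfl⟩ := h x y
    rw [h2 τ hτ, hx] at hy
    exact absurd hy (by decide)
  · rintro ⟨h₀, hh₀, hh₁⟩
    have key : ∀ x, ∃ τ ∈ Subgroup.closure {α, σ}, τ x = h₀ := fun x => by
      by_cases hx : vert x = 0
      · obtain ⟨i, hi⟩ := (hvert x h₀).1 (by rw [hx, hh₀])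
        exact ⟨_, Subgroup.zpow_mem _ hσσ i, hi⟩
      · obtain ⟨i, hi⟩ := (hvert x (α h₀)).1 (by omega)
        exact ⟨_, Subgroup.mul_mem _ hασ (Subgroup.zpow_mem _ hσσ i), by
          rw [Perm.mul_apply, hi, hα]⟩
    intro x y
    obtain ⟨τ, hτ, hx⟩ := key x
    obtain ⟨τ', hτ', hy⟩ := key y
    exact ⟨_, Subgroup.mul_mem _ (Subgroup.inv_mem _ hτ') hτ, by
      rw [Perm.mul_apply, hx, Perm.inv_eq_iff_eq, hy]⟩

end Connected

/-- The circle that contains a point. -/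
def side {μ ν : ℕ} : Fin μ ⊕ Fin ν → Fin 2 := Sum.elim (fun _ => 0) fun _ => 1

@[simp] theorem side_inl {μ ν : ℕ} (i : Fin μ) : side (Sum.inl i : Fin μ ⊕ Fin ν) = 0 := rfl

@[simp] theorem side_inr {μ ν : ℕ} (j : Fin ν) : side (Sum.inr j : Fin μ ⊕ Fin ν) = 1 := rfl

theorem side_circles {μ ν : ℕ} (x : Fin μ ⊕ Fin ν) : side (circles μ ν x) = side x := by
  cases x <;> rfl

theorem circles_pow_inl {m ν : ℕ} (k : ℕ) :
    (circles (m + 1) ν ^ k) (Sum.inl 0) = Sum.inl (Fin.ofNat (m + 1) k) := by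
  induction k with
  | zero => simp
  | succ k ih =>
    rw [pow_succ', Perm.mul_apply, ih, circles_inl, finRotate_apply]
    congr 1
    ext
    simp [Fin.val_add]

theorem circles_pow_inr {μ m : ℕ} (k : ℕ) :
    (circles μ (m + 1) ^ k) (Sum.inr 0) = Sum.inr (Fin.ofNat (m + 1) k) := by
  induction k with
  | zero => simp
  | succ k ih =>
    rw [pow_succ', Perm.mul_apply, ih, circles_inr, finRotate_apply]
    congr 1
    ext
    simp [Fin.val_add]

theorem side_eq_iff {m k : ℕ} (x y : Fin (m + 1) ⊕ Fin (k + 1)) :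
    side x = side y ↔ (circles (m + 1) (k + 1)).SameCycle x y := by
  refine ⟨fun h => ?_, eq_of_sameCycle side_circles⟩
  have hl : ∀ i, (circles (m + 1) (k + 1)).SameCycle (Sum.inl 0) (Sum.inl i) := fun i =>
    ⟨((i : ℕ) : ℤ), by
      rw [zpow_natCast, circles_pow_inl]; congr 1; ext; simp⟩
  have hr : ∀ i, (circles (m + 1) (k + 1)).SameCycle (Sum.inr 0) (Sum.inr i) := fun i =>
    ⟨((i : ℕ) : ℤ), by
      rw [zpow_natCast, circles_pow_inr]; congr 1; ext; simp⟩
  rcases x with x | x <;> rcases y with y | y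
  · exact (hl x).symm.trans (hl y)
  · cases h
  · cases h
  · exact (hr x).symm.trans (hr y)

theorem isAnnular_iff {m k : ℕ} {α : Perm (Fin (m + 1) ⊕ Fin (k + 1))} :
    IsAnnular α ↔ (∀ x, α (α x) = x) ∧ (∀ x, α x ≠ x) ∧
      (∃ x, side x = 0 ∧ side (α x) = 1) ∧
      2 * numCycles ((circles (m + 1) (k + 1))⁻¹ * α) = (m + 1) + (k + 1) := by
  have hlink : (∃ i j, α (Sum.inl i) = Sum.inr j) ↔ ∃ x, side x = 0 ∧ side (α x) = 1 := by
    constructor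
    · rintro ⟨i, j, h⟩
      exact ⟨Sum.inl i, rfl, by rw [h]; rfl⟩
    · rintro ⟨x | x, h0, h1⟩
      · cases h : α (Sum.inl x) with
        | inl y => rw [h] at h1; simp at h1
        | inr y => exact ⟨x, y, h⟩
      · simp at h0
  rw [← hlink]
  exact ⟨fun h => ⟨h.1, h.2, h.3, h.4⟩, fun h => ⟨h.1, h.2.1, h.2.2.1, h.2.2.2⟩⟩

/-! ### From weighted graphs to annular pairings. -/

section Graph

open MarkedGraph

variable {m k e : ℕ}

/-- The marked graph of an annular pairing, its half-edges being numbered by `E`. -/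
def annularMarkedGraph (E : Fin (m + 1) ⊕ Fin (k + 1) ≃ Fin (2 * e))
    (α : Perm (Fin (m + 1) ⊕ Fin (k + 1))) (hα : IsAnnular α) : MarkedGraph e 2 :=
  have hsurj : Function.Surjective fun h => side (E.symm h) := fun i => by
    fin_cases i
    · exact ⟨E (Sum.inl 0), by simp⟩
    · exact ⟨E (Sum.inr 0), by simp⟩
  have hvert : ∀ h h', side (E.symm h) = side (E.symm h') ↔
      (E.permCongr (circles (m + 1) (k + 1))).SameCycle h h' := fun h h' => by
    rw [side_eq_iff, ← sameCycle_apply_iff E (ψ := E.permCongr (circles (m + 1) (k + 1)))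
      (fun x => by simp [Equiv.permCongr_apply]), Equiv.apply_symm_apply, Equiv.apply_symm_apply]
  have hinv : ∀ h, E.permCongr α (E.permCongr α h) = h := fun h => by
    simp [Equiv.permCongr_apply, hα.involutive]
  { e_pos := by have := (E (Sum.inl 0)).2; omega
    α := E.permCongr α
    σ := E.permCongr (circles (m + 1) (k + 1))
    α_involutive := hinv
    α_fixedPointFree := fun h => by
      rw [Equiv.permCongr_apply, Ne, ← Equiv.eq_symm_apply]
      exact hα.fixedPointFree _
    connected := by
      refine (transitive_iff_exists_link hsurj hvert hinv).2 ?_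
      obtain ⟨x, h0, h1⟩ := (isAnnular_iff.1 hα).2.2.1
      exact ⟨E x, by simpa using h0, by simpa [Equiv.permCongr_apply] using h1⟩
    vert := fun h => side (E.symm h)
    vert_surjective := hsurj
    vert_eq_iff := hvert }

/-- A parametrization of the half-edges of a graph with two vertices by the points of two circles
which respects the cyclic orders at the vertices. -/
structure IsRooting (Γ : MarkedGraph e 2) (ψ : Fin (m + 1) ⊕ Fin (k + 1) ≃ Fin (2 * e)) :
    Prop where
  map_circles : ∀ x, ψ (circles (m + 1) (k + 1) x) = Γ.σ (ψ x)
  vert_eq : ∀ x, Γ.vert (ψ x) = side x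

theorem isRooting_annularMarkedGraph (E : Fin (m + 1) ⊕ Fin (k + 1) ≃ Fin (2 * e))
    {α : Perm (Fin (m + 1) ⊕ Fin (k + 1))} (hα : IsAnnular α) :
    IsRooting (annularMarkedGraph E α hα) E :=
  ⟨fun x => by simp [annularMarkedGraph, Equiv.permCongr_apply],
    fun x => by simp [annularMarkedGraph]⟩

theorem annularMarkedGraph_α (E : Fin (m + 1) ⊕ Fin (k + 1) ≃ Fin (2 * e))
    {α : Perm (Fin (m + 1) ⊕ Fin (k + 1))} (hα : IsAnnular α) :
    (annularMarkedGraph E α hα).α = E.permCongr α := rfl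

variable {Γ : MarkedGraph e 2} {ψ : Fin (m + 1) ⊕ Fin (k + 1) ≃ Fin (2 * e)}

theorem IsRooting.degree (h : IsRooting Γ ψ) (i : Fin 2) :
    Γ.degree i = ![m + 1, k + 1] i := by
  have h1 : Γ.degree i = (Finset.univ.filter fun x : Fin (m + 1) ⊕ Fin (k + 1) =>
      side x = i).card := by
    symm
    refine Finset.card_equiv ψ fun x => ?_
    simp [h.vert_eq]
  rw [h1]
  fin_cases i
  · rw [show (Finset.univ.filter fun x : Fin (m + 1) ⊕ Fin (k + 1) => side x = (⟨0, by simp⟩ : Fin 2))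
        = Finset.univ.map Function.Embedding.inl by
      ext (x | x) <;> simp]
    simp
  · rw [show (Finset.univ.filter fun x : Fin (m + 1) ⊕ Fin (k + 1) => side x = (⟨1, by simp⟩ : Fin 2))
        = Finset.univ.map Function.Embedding.inr by
      ext (x | x) <;> simp]
    simp

theorem IsRooting.numCycles_eq_numFaces (h : IsRooting Γ ψ) :
    numCycles ((circles (m + 1) (k + 1))⁻¹ * ψ.symm.permCongr Γ.α) = Γ.numFaces := by
  refine numCycles_conj ψ fun x => ?_
  rw [Perm.mul_apply, Perm.mul_apply, Perm.eq_inv_iff_eq, ← h.map_circles,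
    ← Perm.mul_apply (circles _ _), mul_inv_cancel]
  simp [Equiv.permCongr_apply]

/-- With two vertices, Euler's relation for genus 0 says that there are as many faces as edges, and
twice the number of edges is the number of points. -/
theorem IsRooting.isAnnular_iff_hasGenus (h : IsRooting Γ ψ) :
    IsAnnular (ψ.symm.permCongr Γ.α) ↔ Γ.HasGenus 0 := by
  have hcard : (m + 1) + (k + 1) = 2 * e := by
    simpa using Fintype.card_congr ψ
  rw [isAnnular_iff, h.numCycles_eq_numFaces, MarkedGraph.HasGenus]
  constructor
  · rintro ⟨-, -, -, h⟩
    push_cast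
    omega
  · intro hg
    refine ⟨fun x => by simp [Equiv.permCongr_apply, Γ.α_involutive], fun x => ?_, ?_, ?_⟩
    · rw [Equiv.permCongr_apply, Ne, ← Equiv.eq_symm_apply]
      exact Γ.α_fixedPointFree _
    · obtain ⟨x, h0, h1⟩ := (transitive_iff_exists_link Γ.vert_surjective Γ.vert_eq_iff
        Γ.α_involutive).1 Γ.connected
      refine ⟨ψ.symm x, ?_, ?_⟩
      · rw [← h.vert_eq]; simpa using h0
      · rw [← h.vert_eq]; simpa [Equiv.permCongr_apply] using h1
    · push_cast at hg
      omega

/-- The marked graph of an annular pairing as a planar graph with given degrees. -/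
def annularGraphData (E : Fin (m + 1) ⊕ Fin (k + 1) ≃ Fin (2 * e))
    (α : {α : Perm (Fin (m + 1) ⊕ Fin (k + 1)) // IsAnnular α}) :
    GraphData 0 2 ![m + 1, k + 1] e :=
  ⟨annularMarkedGraph E α.1 α.2, (isRooting_annularMarkedGraph E α.2).isAnnular_iff_hasGenus.1 (by
    rw [annularMarkedGraph_α]
    convert α.2
    ext x
    simp [Equiv.permCongr_apply]), (isRooting_annularMarkedGraph E α.2).degree⟩

/-- Once a numbering `E` is fixed, this makes the rootings that induce `α` a torsor under the
automorphism group, as soon as one exists. -/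
theorem isRooting_and_conj_eq_iff {E : Fin (m + 1) ⊕ Fin (k + 1) ≃ Fin (2 * e)}
    {α : Perm (Fin (m + 1) ⊕ Fin (k + 1))} (hα : IsAnnular α) :
    (IsRooting Γ ψ ∧ ψ.symm.permCongr Γ.α = α) ↔
      IsMarkedIso (annularMarkedGraph E α hα) Γ (E.symm.trans ψ) := by
  have h1 := (isRooting_annularMarkedGraph E hα).map_circles
  have h2 := (isRooting_annularMarkedGraph E hα).vert_eq
  have h3 : ∀ x, E (α x) = (annularMarkedGraph E α hα).α (E x) := fun x => by
    simp [annularMarkedGraph_α, Equiv.permCongr_apply]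
  constructor
  · rintro ⟨h, rfl⟩
    refine ⟨Equiv.ext ?_, Equiv.ext ?_, ?_⟩
    · rw [← E.forall_congr_right]
      intro x
      simp only [Perm.mul_apply, ← h3]
      simp [Equiv.permCongr_apply]
    · rw [← E.forall_congr_right]
      intro x
      simp only [Perm.mul_apply, ← h1]
      simp [h.map_circles]
    · rw [← E.forall_congr_right]
      intro x
      simp [h2, h.vert_eq]
  · rintro ⟨hα', hσ, hv⟩
    refine ⟨⟨fun x => ?_, fun x => ?_⟩, Equiv.ext fun x => ?_⟩
    · have := congrArg (fun f => f (E x)) hσ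
      simp only [Perm.mul_apply, ← h1] at this
      simpa using this.symm
    · simpa [h2] using hv (E x)
    · have := congrArg (fun f => f (E x)) hα'
      simp only [Perm.mul_apply, ← h3] at this
      simp only [Equiv.trans_apply, Equiv.symm_apply_apply] at this
      simp [Equiv.permCongr_apply, this]

theorem card_isMarkedIso {G Γ : MarkedGraph e 2} {φ₀ : Perm (Fin (2 * e))}
    (h : IsMarkedIso G Γ φ₀) : Nat.card {φ // IsMarkedIso G Γ φ} = Γ.autCard :=
  Nat.card_congr
    { toFun := fun φ => ⟨φ.1 * φ₀⁻¹, φ.2.mul h.inv⟩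
      invFun := fun φ => ⟨φ.1 * φ₀, φ.2.mul h⟩
      left_inv := fun φ => Subtype.ext (by simp)
      right_inv := fun φ => Subtype.ext (by simp) }

theorem IsRooting.apply_inl (h : IsRooting Γ ψ) (i : Fin (m + 1)) :
    ψ (Sum.inl i) = (Γ.σ ^ (i : ℕ)) (ψ (Sum.inl 0)) := by
  have key : ∀ n : ℕ, ψ ((circles (m + 1) (k + 1) ^ n) (Sum.inl 0)) =
      (Γ.σ ^ n) (ψ (Sum.inl 0)) := fun n => by
    induction n with
    | zero => rfl
    | succ n ih => rw [pow_succ', pow_succ', Perm.mul_apply, Perm.mul_apply, h.map_circles, ih]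
  rw [← key, circles_pow_inl]
  congr 2
  ext
  simp

theorem IsRooting.apply_inr (h : IsRooting Γ ψ) (j : Fin (k + 1)) :
    ψ (Sum.inr j) = (Γ.σ ^ (j : ℕ)) (ψ (Sum.inr 0)) := by
  have key : ∀ n : ℕ, ψ ((circles (m + 1) (k + 1) ^ n) (Sum.inr 0)) =
      (Γ.σ ^ n) (ψ (Sum.inr 0)) := fun n => by
    induction n with
    | zero => rfl
    | succ n ih => rw [pow_succ', pow_succ', Perm.mul_apply, Perm.mul_apply, h.map_circles, ih]
  rw [← key, circles_pow_inr]
  congr 2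
  ext
  simp

theorem vert_pow (Γ : MarkedGraph e 2) (n : ℕ) (h : Fin (2 * e)) :
    Γ.vert ((Γ.σ ^ n) h) = Γ.vert h :=
  (Γ.vert_eq_iff _ _).2 (Perm.sameCycle_pow_left.2 (Perm.SameCycle.refl _ _))

theorem pow_degree (Γ : MarkedGraph e 2) (h₀ : Fin (2 * e)) {n : ℕ}
    (hn : Γ.degree (Γ.vert h₀) = n) : (Γ.σ ^ n) h₀ = h₀ ∧
      ∀ h, Γ.vert h = Γ.vert h₀ → ∃ i : Fin n, (Γ.σ ^ (i : ℕ)) h₀ = h := by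
  refine pow_card_sameCycle Γ.σ (s := {h | Γ.vert h = Γ.vert h₀})
    (fun h => ?_) ?_
  · rw [← Γ.vert_eq_iff, Set.mem_ofPred_eq, eq_comm]
  · rw [← hn, MarkedGraph.degree, ← Fintype.card_subtype]
    exact Nat.card_eq_fintype_card

theorem pow_finRotate {n : ℕ} (σ : Perm (Fin (2 * e))) {h : Fin (2 * e)}
    (hn : (σ ^ n) h = h) (i : Fin n) :
    (σ ^ (finRotate n i : ℕ)) h = σ ((σ ^ (i : ℕ)) h) := by
  rw [finRotate_val, ← Perm.mul_apply, ← pow_succ']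
  split_ifs with hi
  · rw [hi, hn, pow_zero, Perm.one_apply]
  · rfl

/-- A rooting is determined by the images of the two base points, which can be any half-edges at the
respective vertices; powers of `σ` give the rest. -/
theorem card_isRooting (hdeg : ∀ i, Γ.degree i = ![m + 1, k + 1] i) :
    Nat.card {ψ : Fin (m + 1) ⊕ Fin (k + 1) ≃ Fin (2 * e) // IsRooting Γ ψ} =
      (m + 1) * (k + 1) := by
  have hcard : (m + 1) + (k + 1) = 2 * e := by
    have := Γ.sum_degree
    rw [Fin.sum_univ_two, hdeg, hdeg] at this
    simpa using this
  let F : {ψ : Fin (m + 1) ⊕ Fin (k + 1) ≃ Fin (2 * e) // IsRooting Γ ψ} →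
      {h // Γ.vert h = 0} × {h // Γ.vert h = 1} := fun ψ =>
    (⟨ψ.1 (Sum.inl 0), ψ.2.vert_eq _⟩, ⟨ψ.1 (Sum.inr 0), ψ.2.vert_eq _⟩)
  have hF : Function.Bijective F := by
    constructor
    · intro ψ φ h
      have h0 : ψ.1 (Sum.inl 0) = φ.1 (Sum.inl 0) := congrArg (fun p => p.1.1) h
      have h1 : ψ.1 (Sum.inr 0) = φ.1 (Sum.inr 0) := congrArg (fun p => p.2.1) h
      refine Subtype.ext (Equiv.ext ?_)
      rintro (x | x)
      · rw [ψ.2.apply_inl, φ.2.apply_inl, h0]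
      · rw [ψ.2.apply_inr, φ.2.apply_inr, h1]
    · rintro ⟨⟨a, ha⟩, ⟨b, hb⟩⟩
      obtain ⟨ha1, ha2⟩ := pow_degree Γ a (n := m + 1) (by rw [ha, hdeg]; rfl)
      obtain ⟨hb1, hb2⟩ := pow_degree Γ b (n := k + 1) (by rw [hb, hdeg]; rfl)
      let f : Fin (m + 1) ⊕ Fin (k + 1) → Fin (2 * e) :=
        Sum.elim (fun i => (Γ.σ ^ (i : ℕ)) a) fun j => (Γ.σ ^ (j : ℕ)) b
      have hf : Function.Bijective f := by
        refine (Fintype.bijective_iff_surjective_and_card _).2 ⟨fun h => ?_, by simpa using hcard⟩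
        by_cases hh : Γ.vert h = 0
        · obtain ⟨i, hi⟩ := ha2 h (by rw [hh, ha])
          exact ⟨Sum.inl i, hi⟩
        · obtain ⟨i, hi⟩ := hb2 h (by rw [hb]; omega)
          exact ⟨Sum.inr i, hi⟩
      refine ⟨⟨Equiv.ofBijective f hf, ⟨?_, ?_⟩⟩, ?_⟩
      · rintro (x | x)
        · exact pow_finRotate _ ha1 x
        · exact pow_finRotate _ hb1 x
      · rintro (x | x)
        · exact (vert_pow Γ _ _).trans ha
        · exact (vert_pow Γ _ _).trans hb
      · simp [F, f]
  rw [Nat.card_eq_of_bijective F hF, Nat.card_prod]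
  have hd : ∀ i, Nat.card {h // Γ.vert h = i} = Γ.degree i := fun i => by
    rw [MarkedGraph.degree, ← Fintype.card_subtype, Nat.card_eq_fintype_card]
  rw [hd, hd, hdeg, hdeg]
  rfl

-- Double counting of the rootings of `G`, fibred over the pairing they induce: a fibre is empty or
-- has as many elements as the automorphism group.
open Classical in
theorem card_fiber_mul_autCard (E : Fin (m + 1) ⊕ Fin (k + 1) ≃ Fin (2 * e))
    (G : GraphData 0 2 ![m + 1, k + 1] e) :
    (Finset.univ.filter fun α : {α : Perm (Fin (m + 1) ⊕ Fin (k + 1)) // IsAnnular α} =>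
      annularGraphData E α ≈ G).card * G.1.autCard = (m + 1) * (k + 1) := by
  rw [← card_isRooting G.2.2]
  let f : {ψ : Fin (m + 1) ⊕ Fin (k + 1) ≃ Fin (2 * e) // IsRooting G.1 ψ} →
      {α : Perm (Fin (m + 1) ⊕ Fin (k + 1)) // IsAnnular α} :=
    fun ψ => ⟨ψ.1.symm.permCongr G.1.α, ψ.2.isAnnular_iff_hasGenus.2 G.2.1⟩
  rw [Nat.card_congr (Equiv.sigmaFiberEquiv f).symm, Nat.card_sigma]
  have hfiber : ∀ α, Nat.card {ψ // f ψ = α} =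
      Nat.card {φ // IsMarkedIso (annularMarkedGraph E α.1 α.2) G.1 φ} := fun α =>
    Nat.card_congr
      { toFun := fun ψ => ⟨E.symm.trans ψ.1.1,
          (isRooting_and_conj_eq_iff α.2).1 ⟨ψ.1.2, congrArg Subtype.val ψ.2⟩⟩
        invFun := fun φ =>
          have h := (isRooting_and_conj_eq_iff (ψ := E.trans φ.1) (E := E) α.2).2 (by
            rw [← Equiv.trans_assoc, Equiv.symm_trans_self, Equiv.refl_trans]; exact φ.2)
          ⟨⟨E.trans φ.1, h.1⟩, Subtype.ext h.2⟩
        left_inv := fun ψ => Subtype.ext (Subtype.ext (by ext x; simp))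
        right_inv := fun φ => Subtype.ext (by ext x; simp) }
  have hval : ∀ α, Nat.card {ψ // f ψ = α} =
      if annularGraphData E α ≈ G then G.1.autCard else 0 := fun α => by
    rw [hfiber]
    split_ifs with h
    · obtain ⟨φ, hφ⟩ := h
      exact card_isMarkedIso hφ
    · have : IsEmpty {φ // IsMarkedIso (annularMarkedGraph E α.1 α.2) G.1 φ} :=
        ⟨fun φ => h ⟨φ.1, φ.2⟩⟩
      exact Nat.card_of_isEmpty
  rw [Finset.sum_congr rfl fun α _ => hval α, Finset.sum_ite, Finset.sum_const_zero, add_zero,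
    Finset.sum_const, smul_eq_mul]

theorem MarkedGraphs.add_eq_two_mul (Γ : MarkedGraphs 0 2 ![m + 1, k + 1]) :
    (m + 1) + (k + 1) = 2 * Γ.1 := by
  obtain ⟨e, q⟩ := Γ
  induction q using Quotient.inductionOn with
  | h G =>
    have := G.1.sum_degree
    rw [Fin.sum_univ_two, G.2.2, G.2.2] at this
    simpa using this

theorem C_eq_zero_of_odd (h : ∀ e, (m + 1) + (k + 1) ≠ 2 * e) : C 0 2 ![m + 1, k + 1] = 0 := by
  have : IsEmpty (MarkedGraphs 0 2 ![m + 1, k + 1]) := ⟨fun Γ => h _ (MarkedGraphs.add_eq_two_mul Γ)⟩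
  simp [C, D, finsum_of_isEmpty]

theorem C_eq_count (h : (m + 1) + (k + 1) = 2 * e) :
    C 0 2 ![m + 1, k + 1] = count (IsAnnular (μ := m + 1) (ν := k + 1)) := by
  classical
  let E : Fin (m + 1) ⊕ Fin (k + 1) ≃ Fin (2 * e) := finSumFinEquiv.trans (finCongr h)
  let g : {α : Perm (Fin (m + 1) ⊕ Fin (k + 1)) // IsAnnular α} →
      MarkedGraphs 0 2 ![m + 1, k + 1] := fun α => ⟨e, Quotient.mk _ (annularGraphData E α)⟩
  let _ : Fintype (MarkedGraphs 0 2 ![m + 1, k + 1]) := Fintype.ofFinite _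
  have hfiber : ∀ Γ : MarkedGraphs 0 2 ![m + 1, k + 1],
      (Finset.univ.filter fun α => g α = Γ).card * Γ.autCard = (m + 1) * (k + 1) := by
    rintro ⟨e', q⟩
    have he : e' = e := by
      have := MarkedGraphs.add_eq_two_mul (⟨e', q⟩ : MarkedGraphs 0 2 ![m + 1, k + 1])
      simp only at this
      omega
    subst he
    induction q using Quotient.inductionOn with
    | h G =>
      rw [← card_fiber_mul_autCard E G]
      congr 2
      ext α
      simp only [Finset.mem_filter, Finset.mem_univ, true_and, g]
      constructor
      · intro h
        exact Quotient.exact (eq_of_heq (Sigma.mk.inj h).2)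
      · intro h
        rw [Quotient.sound h]
  have hterm : ∀ Γ : MarkedGraphs 0 2 ![m + 1, k + 1],
      ((m : ℚ) + 1) * (k + 1) * (1 / (Γ.autCard : ℚ)) =
        ((Finset.univ.filter fun α => g α = Γ).card : ℚ) := fun Γ => by
    have h1 := hfiber Γ
    -- The orbit count itself shows this: the product in `hfiber` is positive.
    have h2 : (Γ.autCard : ℚ) ≠ 0 := by
      intro h
      rw [Nat.cast_eq_zero] at h
      rw [h, mul_zero] at h1
      exact absurd h1.symm (by positivity)
    rw [mul_one_div, div_eq_iff h2]
    exact_mod_cast h1.symm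
  have hC : C 0 2 ![m + 1, k + 1] = ((m : ℚ) + 1) * (k + 1) * D 0 2 ![m + 1, k + 1] := by
    simp [C]
  rw [hC, D, finsum_eq_sum_of_fintype, Finset.mul_sum, Finset.sum_congr rfl fun Γ _ => hterm Γ,
    ← Nat.cast_sum, ← Finset.card_eq_sum_card_fiberwise (f := g) (s := Finset.univ)
      fun _ _ => Finset.mem_coe.2 (Finset.mem_univ _),
    Finset.card_univ, count, Nat.card_eq_fintype_card]

end Graph

/-! ### Evaluating the binomial sum. -/

section Summation

/-- The binomial coefficient `binom (2 a + r) (a - t)`, zero for `t > a`. -/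
def offsetChoose (r a t : ℕ) : ℕ := if t ≤ a then (2 * a + r).choose (a - t) else 0

theorem offsetChoose_succ (r a t : ℕ) :
    (offsetChoose r a (t + 1) : ℚ) * (a + t + r + 1) = offsetChoose r a t * (a - t) := by
  unfold offsetChoose
  rcases lt_trichotomy t a with h | rfl | h
  · rw [if_pos h.le, if_pos (Nat.succ_le_of_lt h)]
    obtain ⟨d, rfl⟩ := Nat.exists_eq_add_of_lt h
    have := Nat.choose_succ_right_eq (2 * (t + d + 1) + r) d
    rw [show 2 * (t + d + 1) + r - d = t + d + 1 + t + r + 1 by omega] at this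
    rw [show t + d + 1 - (t + 1) = d by omega, show t + d + 1 - t = d + 1 by omega]
    have h2 : ((t + d + 1 : ℕ) : ℚ) - t = ((d + 1 : ℕ) : ℚ) := by push_cast; ring
    rw [h2]
    exact_mod_cast this.symm
  · simp
  · rw [if_neg (by omega), if_neg (by omega)]
    simp

/-- The sum telescopes. The weight comes from `(a + t + r)(b + t + r) - (a - t)(b - t) = (a + b +
r)(2t + r)`, combined with the ratio of consecutive terms in `offsetChoose_succ`. The upper boundary
term is zero because `offsetChoose r a (a + 1) = 0`. -/
theorem sum_offsetChoose (r a b : ℕ) (h : 0 < a + b + r) :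
    ∑ t ∈ Finset.range (a + 1), (offsetChoose r a t : ℚ) * offsetChoose r b t * (2 * t + r) =
      1 / (a + b + r) * (((a : ℚ) + r) * (2 * a + r).choose a) *
        (((b : ℚ) + r) * (2 * b + r).choose b) := by
  have hne : ((a : ℚ) + b + r) ≠ 0 := by exact_mod_cast h.ne'
  let G : ℕ → ℚ := fun t => ((a : ℚ) + t + r) * (b + t + r) / (a + b + r) *
    offsetChoose r a t * offsetChoose r b t
  have hstep : ∀ t, (offsetChoose r a t : ℚ) * offsetChoose r b t * (2 * t + r) =
      G t - G (t + 1) := fun t => by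
    have h1 := offsetChoose_succ r a t
    have h2 := offsetChoose_succ r b t
    have h3 : G (t + 1) = (offsetChoose r a (t + 1) * ((a : ℚ) + t + r + 1)) *
        (offsetChoose r b (t + 1) * ((b : ℚ) + t + r + 1)) / (a + b + r) := by
      simp only [G]
      push_cast
      ring
    rw [h3, h1, h2]
    simp only [G]
    field_simp
    ring
  rw [Finset.sum_congr rfl fun t _ => hstep t, Finset.sum_range_sub']
  simp [G, offsetChoose]
  field_simp

/-- With `t = a - m`, the common core length is `2t + r`, and only `m' = b - t` can contribute. If
that length is zero or `t > b`, both sides vanish. -/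
theorem sum_range_choose_ite {r a b m : ℕ} (hm : m ≤ a) :
    ∑ m' ∈ Finset.range ((2 * b + r + 1) / 2), (2 * b + r).choose m' *
      (if 2 * b + r - 2 * m' = 2 * a + r - 2 * m then 2 * b + r - 2 * m' else 0) =
      offsetChoose r b (a - m) * (2 * (a - m) + r) := by
  obtain ⟨t, rfl⟩ := Nat.exists_eq_add_of_le hm
  rw [show 2 * (m + t) + r - 2 * m = 2 * t + r by omega, show m + t - m = t by omega]
  by_cases h : t ≤ b ∧ 0 < 2 * t + r
  · rw [Finset.sum_eq_single (b - t)]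
    · rw [if_pos (by omega), offsetChoose, if_pos h.1,
        show 2 * b + r - 2 * (b - t) = 2 * t + r by omega]
    · intro m' hm' hne
      have := Finset.mem_range.1 hm'
      rw [if_neg (by omega), mul_zero]
    · intro hmem
      rw [Finset.mem_range] at hmem
      omega
  · rw [Finset.sum_eq_zero]
    · unfold offsetChoose
      split_ifs with ht
      · rw [show 2 * t + r = 0 by omega, mul_zero]
      · rw [zero_mul]
    · intro m' hm'
      have := Finset.mem_range.1 hm'
      rw [mul_eq_zero]
      right
      split_ifs <;> omega

theorem count_isAnnular_eq_sum {r a b : ℕ} (hr : r ≤ 1) :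
    count (IsAnnular (μ := 2 * a + r) (ν := 2 * b + r)) =
      ∑ t ∈ Finset.range (a + 1), offsetChoose r a t * offsetChoose r b t * (2 * t + r) := by
  rw [count_isAnnular]
  -- For even lengths the range stops before `m = a`, where the core would be empty; the added term
  -- has weight zero.
  have hext : ∀ f : ℕ → ℕ, (r = 0 → f a = 0) →
      ∑ m ∈ Finset.range ((2 * a + r + 1) / 2), f m = ∑ m ∈ Finset.range (a + 1), f m := by
    intro f hf
    rcases Nat.le_one_iff_eq_zero_or_eq_one.1 hr with rfl | rfl
    · rw [show (2 * a + 0 + 1) / 2 = a by omega, Finset.sum_range_succ, hf rfl, add_zero]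
    · rw [show (2 * a + 1 + 1) / 2 = a + 1 by omega]
  rw [hext, ← Finset.sum_range_reflect]
  · refine Finset.sum_congr rfl fun t ht => ?_
    have ht := Finset.mem_range.1 ht
    rw [sum_range_choose_ite (by omega), show a - (a + 1 - 1 - t) = t by omega,
      show a + 1 - 1 - t = a - t by omega, mul_assoc]
    congr 1
    rw [offsetChoose, if_pos (by omega)]
  · rintro rfl
    have := sum_range_choose_ite (r := 0) (b := b) (le_refl a)
    rw [this]
    simp

end Summation

/-! ### The function `g` as a binomial coefficient, and the conclusion. -/

theorem gFun_odd (a : ℕ) : gFun (2 * a + 1) = (a + 1) * (2 * a + 1).choose a := by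
  have h1 : (2 * a + 1).factorial = (2 * a + 1).doubleFactorial * (2 ^ a * a.factorial) := by
    rw [← Nat.doubleFactorial_two_mul]
    exact Nat.factorial_eq_mul_doubleFactorial _
  have h2 := Nat.choose_mul_factorial_mul_factorial (show a ≤ 2 * a + 1 by omega)
  rw [show 2 * a + 1 - a = a + 1 by omega, Nat.factorial_succ a, h1] at h2
  have h3 : ((a.factorial : ℕ) : ℚ) ≠ 0 := by exact_mod_cast a.factorial_ne_zero
  have h4 : ((2 * a + 1).choose a : ℚ) * a.factorial * ((a + 1) * a.factorial) =
      (2 * a + 1).doubleFactorial * (2 ^ a * a.factorial) := by exact_mod_cast h2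
  rw [gFun, show (2 * a + 1) / 2 = a by omega, show (2 * a + 1 - 1) / 2 = a by omega,
    div_eq_iff h3]
  refine mul_right_cancel₀ h3 ?_
  linear_combination -h4

/-- Passing from `2a + 1` to `2a + 2` changes only the power of two in `g`, and the central binomial
coefficient is twice its neighbour in the row above. -/
theorem gFun_even (a : ℕ) :
    gFun (2 * (a + 1)) = ((a + 1 : ℕ) : ℚ) * (2 * (a + 1)).choose (a + 1) := by
  have h1 : gFun (2 * (a + 1)) = 2 * gFun (2 * a + 1) := by
    rw [gFun, gFun, show 2 * (a + 1) / 2 = a + 1 by omega,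
      show (2 * (a + 1) - 1) / 2 = a by omega, show (2 * a + 1) / 2 = a by omega,
      show (2 * a + 1 - 1) / 2 = a by omega]
    ring
  rw [h1, gFun_odd, show 2 * (a + 1) = 2 * a + 1 + 1 by ring, Nat.choose_succ_succ,
    Nat.choose_symm_half]
  push_cast
  ring

theorem gFun_eq_choose {r a : ℕ} (hr : r ≤ 1) (h : 0 < 2 * a + r) :
    gFun (2 * a + r) = ((a : ℚ) + r) * (2 * a + r).choose a := by
  rcases Nat.le_one_iff_eq_zero_or_eq_one.1 hr with rfl | rfl
  · obtain ⟨a, rfl⟩ : ∃ c, a = c + 1 := ⟨a - 1, by omega⟩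
    simpa using gFun_even a
  · simpa using gFun_odd a

theorem count_isAnnular_eq {r a b : ℕ} (hr : r ≤ 1) (ha : 0 < 2 * a + r) (hb : 0 < 2 * b + r) :
    (count (IsAnnular (μ := 2 * a + r) (ν := 2 * b + r)) : ℚ) =
      1 / (a + b + r) * gFun (2 * a + r) * gFun (2 * b + r) := by
  rw [gFun_eq_choose hr ha, gFun_eq_choose hr hb, ← sum_offsetChoose r a b (by omega),
    count_isAnnular_eq_sum hr]
  push_cast
  rfl

end RibbonGraphs

theorem mainTheorem5 (μ₁ μ₂ : ℕ) (hμ₁ : 0 < μ₁) (hμ₂ : 0 < μ₂) :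
    RibbonGraphs.C 0 2 ![μ₁, μ₂] =
      (1 + (-1 : ℚ) ^ (μ₁ + μ₂)) / ((μ₁ : ℚ) + (μ₂ : ℚ)) *
        RibbonGraphs.gFun μ₁ * RibbonGraphs.gFun μ₂ := by
  obtain ⟨m, rfl⟩ : ∃ m, μ₁ = m + 1 := ⟨μ₁ - 1, by omega⟩
  obtain ⟨k, rfl⟩ : ∃ k, μ₂ = k + 1 := ⟨μ₂ - 1, by omega⟩
  rcases Nat.even_or_odd (m + 1 + (k + 1)) with h | h
  · obtain ⟨e, he⟩ := h.two_dvd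
    rw [RibbonGraphs.C_eq_count he, h.neg_one_pow]
    have h₁ : m + 1 = 2 * ((m + 1) / 2) + (m + 1) % 2 := by omega
    -- The sum of the degrees is even, so both have the same residue `r`.
    have h₂ : k + 1 = 2 * ((k + 1) / 2) + (m + 1) % 2 := by omega
    generalize (m + 1) / 2 = a at h₁
    generalize (k + 1) / 2 = b at h₂
    have hr : (m + 1) % 2 ≤ 1 := by omega
    generalize (m + 1) % 2 = r at h₁ h₂ hr
    rw [h₁, h₂, RibbonGraphs.count_isAnnular_eq hr (by omega) (by omega)]
    congr 2
    have : ((a : ℚ) + b + r) ≠ 0 := by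
      have : a + b + r ≠ 0 := by omega
      exact_mod_cast this
    rw [div_eq_div_iff this (by push_cast; contrapose! this; linarith)]
    push_cast
    ring
  · rw [RibbonGraphs.C_eq_zero_of_odd fun e he => Nat.not_even_iff_odd.2 h ⟨e, by omega⟩,
      h.neg_one_pow]
    simp
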